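/- Let $m$ be the arclength measure on the unit circle $\mathbb{T}$, normalized so that $m(\mathbb{T})=1$, and let $dA=\pi^{-1}\,dx\,dy$ be the normalized area measure on the open unit disk $\mathbb{D}$. Let $G:[0,1]\to\mathbb{R}$ be an increasing (i.e. non-decreasing) function with $G(0)=0$ and $0<G(x)<1$ for $x\in(0,1)$ which is continuously differentiable on $(0,1)$ and satisfies $$\int_0^1 \log\log\big(1/G(x)\big)\,dx<\infty .$$ Let $w\in L^1(m)$ be a non-negative Borel measurable function on $\mathbb{T}$ whose carrier set $E=\{x\in\mathbb{T}: w(x)>0\}$ coincides, up to a set of $m$-measure zero, with a union of (an arbitrary family of) non-empty open arcs $I\subseteq\mathbb{T}$ on each of which $$\int_I \log w\,dm>-\infty ,$$ where $\log 0=-\infty$. Let $\mu$ be the finite Borel measure on the closed unit disk given by $$d\mu = G(1-|z|)\,dA(z)+w\,dm .$$ Then the space $\mathcal{P}^2(\mu)$, defined as the closure in $L^2(\mu)$ of the set of analytic polynomials $p(z)=\sum_{n=0}^N p_n z^n$, is irreducible: if $A$ is a Borel set such that the characteristic function $1_A$ belongs to $\mathcal{P}^2(\mu)$, then $1_A=0$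 $\mu$-almost everywhere or $1_A=1$ $\mu$-almost everywhere. -/

import Mathlib

open MeasureTheory Set Polynomial
open scoped ENNReal

namespace MeanSquareApprox

/-- The normalized arclength measure on the unit circle, regarded as a Borel probability measure
on the complex plane: the image of `dt / (2π)` on `(-π, π]` under `t ↦ exp (i t)`. -/
noncomputable def arclength : Measure ℂ :=
  ENNReal.ofReal (2 * Real.pi)⁻¹ •
    (volume.restrict (Ioc (-Real.pi) Real.pi)).map (circleMap 0 1)

/-- The measure `G (1 - |z|) dA(z)` on the open unit disk, where `dA = π⁻¹ dx dy`. -/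
noncomputable def diskPart (G : ℝ → ℝ) : Measure ℂ :=
  ENNReal.ofReal Real.pi⁻¹ •
    (volume.restrict (Metric.ball (0 : ℂ) 1)).withDensity
      (fun z => ENNReal.ofReal (G (1 - ‖z‖)))

/-- The measure `w dm` on the unit circle. Only the values of `w` on the circle matter. -/
noncomputable def circlePart (w : ℂ → ℝ) : Measure ℂ :=
  arclength.withDensity (fun z => ENNReal.ofReal (w z))

/-- The measure `dμ = G (1 - |z|) dA + w dm` on the closed unit disk. -/
noncomputable def diskCircleMeasure (G : ℝ → ℝ) (w : ℂ → ℝ) : Measure ℂ :=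
  diskPart G + circlePart w

/-- The elements of `L²(μ)` that are represented by analytic polynomials. -/
def polynomials (μ : Measure ℂ) : Submodule ℂ (Lp ℂ 2 μ) where
  carrier := {f | ∃ p : ℂ[X], f =ᵐ[μ] fun z => p.eval z}
  zero_mem' := ⟨0, (Lp.coeFn_zero ℂ 2 μ).trans (.of_forall fun z => by simp)⟩
  add_mem' := by
    rintro f g ⟨p, hp⟩ ⟨q, hq⟩
    exact ⟨p + q, (Lp.coeFn_add f g).trans
      ((hp.add hq).trans (.of_forall fun z => by simp))⟩
  smul_mem' := by
    rintro c f ⟨p, hp⟩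
    exact ⟨C c * p, (Lp.coeFn_smul c f).trans
      ((hp.const_smul c).trans (.of_forall fun z => by simp))⟩

/-- The space `P²(μ)`: the closure of the analytic polynomials in `L²(μ)`. -/
noncomputable def P2 (μ : Measure ℂ) : Submodule ℂ (Lp ℂ 2 μ) :=
  (polynomials μ).topologicalClosure

/-- `P²(μ)` is irreducible: the only characteristic functions of Borel sets that it contains
are the trivial ones, equal to `0` or to `1` almost everywhere with respect to `μ`. -/
def IsIrreducibleP2 (μ : Measure ℂ) : Prop :=
  ∀ A : Set ℂ, MeasurableSet A → ∀ f ∈ P2 μ,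
    f =ᵐ[μ] A.indicator (fun _ => (1 : ℂ)) → μ A = 0 ∨ μ Aᶜ = 0

/-- The condition `∫₀¹ log log (1 / G) dx < ∞`, for a function `G` with values in `(0, 1)` on
`(0, 1)`: the positive part of the integrand has a finite integral. -/
def LogLogInt (G : ℝ → ℝ) : Prop :=
  ∫⁻ x in Ioo (0 : ℝ) 1, ENNReal.ofReal (Real.log (Real.log (1 / G x))) < ∞

/-- A (nonempty) open arc of the unit circle. -/
def IsOpenArc (I : Set ℂ) : Prop :=
  ∃ a b : ℝ, a < b ∧ I = circleMap 0 1 '' Ioo a b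

/-- `∫_I log w dm > -∞`, with the convention `log 0 = -∞`, for a non-negative `w ∈ L¹(m)`:
`w` is positive almost everywhere on `I` (a condition needed since `Real.log 0 = 0`), and `log w`
is integrable on `I` (its positive part always is, being at most `w`). -/
def LogIntegrableOn (w : ℂ → ℝ) (I : Set ℂ) : Prop :=
  (∀ᵐ z ∂(arclength.restrict I), 0 < w z) ∧
    IntegrableOn (fun z => Real.log (w z)) I arclength

/-- The carrier set of the weight `w` on the unit circle. -/
def carrierSet (w : ℂ → ℝ) : Set ℂ :=
  {z ∈ Metric.sphere (0 : ℂ) 1 | 0 < w z}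

end MeanSquareApprox

/-!
Suppose that polynomials `p` tend in `L²(μ)` to the characteristic function of `A`. In the open disk
they converge locally uniformly, since point evaluations are bounded (`enorm_eval_sq_le_diskPart`).
Their limit is continuous and takes only the values `0` and `1`, so it is constant
(`diskPart_eq_zero_or_compl`). Passing to the complement of `A` if necessary, suppose that
`p → 0` in the disk; it remains to show that `A` is null on every arc on which `log w` is
integrable.

This is a matter of propagating smallness from the circle to the disk: `q = 1 - p` is small on `A`
and close to `1` at the interior points. The two are compared by means of analytic disks attached to
the arc. Let `φ` be analytic in the unit disk, mapping the arc `|t| < 1` of the unit circle into the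
given arc, and the rest of the unit circle into the open disk. Jensen's inequality gives
`log |q (φ 0)| ≤ ∫ log |q ∘ φ| dt / 2π`. On the part of `|t| < 1` that `φ` maps to `A`, the integral
of `log |q ∘ φ|` tends to `-∞`. On the remainder of that arc, the integral is bounded from above
because `w` and `log w` are integrable. On the rest of the circle, the bound for point
evaluations gives `log |q (φ)| ≤ C + log (1 / (1 - |φ|)) + log (1 / G ((1 - |φ|) / 2))`, roughly. If
the right side has an integral that is bounded independently of `p`, then `log |q (φ 0)|` tends to
`-∞` when `A` has positive measure, although `q (φ 0)` tends to `1`: a contradiction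
(`two_pi_mul_log_half_le`, `exists_volume_preimage_inter_eq_zero`).

The disk is `φ = exp (i (x₀ + Φ))`, where `Φ` is a sum of the functions `2⁻ᵏ stripMap (1 + βₖ)`.
Each `stripMap α` is an explicit combination of logarithms whose imaginary part is `0` on the arc
`|t| < α` and `1` on the complementary arc. The real part of `Φ` on the arc `|t| < 1` stays bounded
if `∑ 2⁻ᵏ log (1 / βₖ) < ∞`, and the integral over the rest of the circle stays bounded if
`∑ βₖ₋₁ log (1 / G (2⁻ᵏ⁻²)) < ∞`, together with a similar series for the other terms. The choice
`βₖ = 2⁻ᵏ⁻¹ / (1 + log (1 / G (2⁻ᵏ⁻³)))` satisfies both conditions, the first one because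
`∫ log log (1 / G) dx < ∞` (`summable_log_arcExcess`, `sum_arcExcess_mul_le`).

The sum defining `Φ` is taken over the finite range `K ≤ k ≤ N`. The number `K` is fixed, and large,
so that the arc `|t| < 1` is mapped into a short arc. The number `N` depends on `p`: the arcs
`1 < |t| < 1 + β_N` are mapped into the circle, but to an arc that can be long, so they have to be
short in comparison with the maximum of `log |q|`.
-/

open MeasureTheory Set Polynomial Filter Topology
open scoped ENNReal
open Complex (I)

/-! ### Mean value inequalities -/

/-- The mean value property of `p ^ 2` on circles. -/
theorem Polynomial.two_pi_mul_enorm_eval_sq_le_lintegral (p : ℂ[X]) (z : ℂ) (ρ : ℝ) :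
    ENNReal.ofReal (2 * Real.pi) * ‖p.eval z‖ₑ ^ 2 ≤
      ∫⁻ θ in Ioo (-Real.pi) Real.pi, ‖p.eval (circleMap z ρ θ)‖ₑ ^ 2 := by
  have hpi := Real.pi_pos
  have hm : Real.circleAverage (fun ζ => p.eval ζ ^ 2) z ρ = p.eval z ^ 2 :=
    DiffContOnCl.circleAverage (f := fun ζ => p.eval ζ ^ 2)
      (Differentiable.diffContOnCl (p.differentiable.pow 2))
  have hI : ∫ θ in Ioc (-Real.pi) Real.pi, p.eval (circleMap z ρ θ) ^ 2 =
      (2 * Real.pi) • p.eval z ^ 2 := by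
    rw [← hm, Real.circleAverage_def, smul_inv_smul₀ (by positivity),
      ← intervalIntegral.integral_of_le (by linarith)]
    have hper : Function.Periodic (fun θ => p.eval (circleMap z ρ θ) ^ 2) (2 * Real.pi) :=
      fun x => by simp only [periodic_circleMap z ρ x]
    have := hper.intervalIntegral_add_eq (-Real.pi) 0
    rw [zero_add, show -Real.pi + 2 * Real.pi = Real.pi by ring] at this
    exact this
  calc ENNReal.ofReal (2 * Real.pi) * ‖p.eval z‖ₑ ^ 2
      = ‖∫ θ in Ioc (-Real.pi) Real.pi, p.eval (circleMap z ρ θ) ^ 2‖ₑ := by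
        rw [hI, enorm_smul, enorm_pow, Real.enorm_of_nonneg (by positivity)]
    _ ≤ ∫⁻ θ in Ioc (-Real.pi) Real.pi, ‖p.eval (circleMap z ρ θ) ^ 2‖ₑ :=
        enorm_integral_le_lintegral_enorm _
    _ = _ := by
        rw [← restrict_Ioo_eq_restrict_Ioc]
        simp only [enorm_pow]

/-- The mean value inequality on disks, by integration in polar coordinates. -/
theorem Polynomial.enorm_eval_sq_le_lintegral_ball (p : ℂ[X]) (z : ℂ) {r : ℝ} (hr : 0 ≤ r) :
    ENNReal.ofReal (Real.pi * r ^ 2) * ‖p.eval z‖ₑ ^ 2 ≤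
      ∫⁻ ζ in Metric.ball z r, ‖p.eval ζ‖ₑ ^ 2 := by
  have hpi := Real.pi_pos
  set f : ℂ → ℝ≥0∞ := (Metric.ball 0 r).indicator fun ζ => ‖p.eval (z + ζ)‖ₑ ^ 2 with hf
  have hfm : Measurable f := by
    refine Measurable.indicator ?_ measurableSet_ball
    exact ((p.continuous.comp (continuous_const.add continuous_id)).enorm).measurable.pow_const 2
  have h1 : ∫⁻ ζ in Metric.ball z r, ‖p.eval ζ‖ₑ ^ 2 = ∫⁻ ζ, f ζ := by
    rw [← lintegral_indicator measurableSet_ball, ← lintegral_add_left_eq_self _ z]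
    congr 1
    ext ζ
    simp [hf, indicator, dist_eq_norm]
  have h2 : ∀ ρ ∈ Ioi (0 : ℝ), (Ioo 0 r).indicator (fun ρ => ENNReal.ofReal ρ *
      (ENNReal.ofReal (2 * Real.pi) * ‖p.eval z‖ₑ ^ 2)) ρ ≤
      ∫⁻ θ in Ioo (-Real.pi) Real.pi, ENNReal.ofReal ρ * f (Complex.polarCoord.symm (ρ, θ)) := by
    intro ρ hρ
    by_cases hρr : ρ < r
    · rw [indicator_of_mem (show ρ ∈ Ioo 0 r from ⟨hρ, hρr⟩),
        lintegral_const_mul' _ _ ENNReal.ofReal_ne_top]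
      gcongr
      refine (p.two_pi_mul_enorm_eval_sq_le_lintegral z ρ).trans_eq ?_
      congr 1
      ext θ
      have : Complex.polarCoord.symm (ρ, θ) ∈ Metric.ball (0 : ℂ) r := by
        rw [mem_ball_zero_iff, Complex.norm_polarCoord_symm, abs_of_pos hρ]
        exact hρr
      rw [hf, indicator_of_mem this, Complex.polarCoord_symm_apply, circleMap, Complex.exp_mul_I]
      push_cast
      rfl
    · rw [indicator_of_notMem (fun h : ρ ∈ Ioo 0 r => hρr h.2)]
      exact zero_le
  rw [h1, ← Complex.lintegral_comp_polarCoord_symm]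
  change _ ≤ ∫⁻ x in Ioi (0 : ℝ) ×ˢ Ioo (-Real.pi) Real.pi,
    ENNReal.ofReal x.1 * f (Complex.polarCoord.symm x)
  rw [Measure.volume_eq_prod, ← Measure.prod_restrict, lintegral_prod]
  · refine le_trans ?_ (setLIntegral_mono' measurableSet_Ioi h2)
    rw [lintegral_indicator measurableSet_Ioo, Measure.restrict_restrict measurableSet_Ioo,
      inter_eq_left.2 (fun x hx => hx.1), lintegral_mul_const _ (by fun_prop),
      ← ofReal_integral_eq_lintegral_ofReal, ← integral_Ioc_eq_integral_Ioo,
      ← intervalIntegral.integral_of_le hr, integral_id, ← mul_assoc, ← ENNReal.ofReal_mul]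
    · refine le_of_eq ?_
      congr 2; ring
    · rw [zero_pow two_ne_zero, sub_zero]; positivity
    · exact (continuous_id.integrableOn_Icc (a := 0) (b := r)).mono_set Ioo_subset_Icc_self
    · exact (ae_restrict_mem measurableSet_Ioo).mono fun x hx => hx.1.le
  · refine Measurable.aemeasurable ?_
    refine Measurable.mul (by fun_prop) (hfm.comp ?_)
    have : ⇑Complex.polarCoord.symm =
        fun q : ℝ × ℝ => (q.1 : ℂ) * (Real.cos q.2 + Real.sin q.2 * I) :=
      _root_.funext fun q => Complex.polarCoord_symm_apply q
    rw [this]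
    fun_prop

theorem circleAverage_zero_eq_integral_Ioo (f : ℂ → ℝ) (R : ℝ) :
    Real.circleAverage f 0 R =
      (2 * Real.pi)⁻¹ * ∫ t in Ioo (-Real.pi) Real.pi, f (circleMap 0 R t) := by
  rw [← integral_Ioc_eq_integral_Ioo,
    ← intervalIntegral.integral_of_le (by linarith [Real.pi_pos]), Real.circleAverage_def,
    smul_eq_mul]
  have hper : Function.Periodic (fun θ => f (circleMap 0 R θ)) (2 * Real.pi) :=
    fun x => by simp only [periodic_circleMap 0 R x]
  have := hper.intervalIntegral_add_eq (-Real.pi) 0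
  rw [zero_add, show -Real.pi + 2 * Real.pi = Real.pi by ring] at this
  rw [this]

/-- The consequence of Jensen's formula that `log ‖g‖` is subharmonic. -/
theorem AnalyticOnNhd.log_norm_le_circleAverage {g : ℂ → ℂ} {c : ℂ} {R : ℝ} (hR : R ≠ 0)
    (hg : AnalyticOnNhd ℂ g (Metric.closedBall c |R|)) (h0 : g c ≠ 0) :
    Real.log ‖g c‖ ≤ Real.circleAverage (fun ζ => Real.log ‖g ζ‖) c R := by
  rw [hg.circleAverage_log_norm hR h0]
  refine le_add_of_nonneg_left (finsum_nonneg fun u => ?_)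
  by_cases hu : u ∈ Metric.closedBall c |R|
  · have hd := MeromorphicOn.AnalyticOnNhd.divisor_nonneg hg u
    refine mul_nonneg (by exact_mod_cast hd) ?_
    rw [← Real.log_abs, abs_mul, abs_of_nonneg (inv_nonneg.2 (norm_nonneg _)), ← div_eq_mul_inv]
    rcases eq_or_ne u c with rfl | hne
    · simp
    · apply Real.log_nonneg
      rw [one_le_div (norm_pos_iff.2 (sub_ne_zero.2 hne.symm)), ← dist_eq_norm, dist_comm]
      exact hu
  · rw [Function.locallyFinsuppWithin.apply_eq_zero_of_notMem _ hu]
    simp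

namespace MeanSquareApprox

/-- Jensen's inequality on the unit circle, for a bounded analytic function in the disk
which is continuous up to almost all points of the circle. The logarithm is truncated from below,
so that dominated convergence applies to the circles of radius `R < 1`. -/
theorem log_norm_le_integral_log_max {g : ℂ → ℂ} {M δ : ℝ} (hδ : 0 < δ)
    (hg : ∀ ζ, ‖ζ‖ < 1 → AnalyticAt ℂ g ζ) (hM : ∀ ζ, ‖g ζ‖ ≤ M) (h0 : g 0 ≠ 0)
    (hc : ∀ᵐ t : ℝ ∂(volume.restrict (Ioo (-Real.pi) Real.pi)),
      ContinuousAt g (Complex.exp (t * I))) :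
    IntegrableOn (fun t : ℝ => Real.log (max ‖g (Complex.exp (t * I))‖ δ))
      (Ioo (-Real.pi) Real.pi) ∧
    2 * Real.pi * Real.log ‖g 0‖ ≤
      ∫ t in Ioo (-Real.pi) Real.pi, Real.log (max ‖g (Complex.exp (t * I))‖ δ) := by
  have hpi := Real.pi_pos
  set u : ℂ → ℝ := fun ζ => Real.log (max ‖g ζ‖ δ) with hu
  set μ := volume.restrict (Ioo (-Real.pi) Real.pi) with hμ
  have hcont : ∀ ζ, ContinuousAt g ζ → ContinuousAt u ζ := fun ζ h =>
    (h.norm.max continuousAt_const).log (lt_max_of_lt_right hδ).ne'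
  set C := |Real.log δ| + |Real.log (max M δ)| with hC
  have hbound : ∀ ζ, ‖u ζ‖ ≤ C := by
    intro ζ
    have h1 : Real.log δ ≤ u ζ := Real.log_le_log hδ (le_max_right _ _)
    have h2 : u ζ ≤ Real.log (max M δ) :=
      Real.log_le_log (lt_max_of_lt_right hδ) (max_le_max_right _ (hM ζ))
    rw [Real.norm_eq_abs, abs_le]
    constructor
    · linarith [neg_abs_le (Real.log δ), abs_nonneg (Real.log (max M δ))]
    · linarith [le_abs_self (Real.log (max M δ)), abs_nonneg (Real.log δ)]
  have hcirc : ∀ R : ℝ, 0 < R → R < 1 → Continuous fun t => u (circleMap 0 R t) := by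
    intro R h0R hR
    refine continuous_iff_continuousAt.2 fun t => ?_
    refine ContinuousAt.comp (g := u) ?_ (continuous_circleMap 0 R).continuousAt
    refine hcont _ (hg _ ?_).continuousAt
    rw [norm_circleMap_zero, abs_of_pos h0R]; exact hR
  have hev : ∀ᶠ R : ℝ in 𝓝[<] 1, 0 < R ∧ R < 1 := by
    filter_upwards [self_mem_nhdsWithin, mem_nhdsWithin_of_mem_nhds (lt_mem_nhds one_pos)]
      with R h1 h2 using ⟨h2, h1⟩
  have hlim : ∀ᵐ t ∂μ, Tendsto (fun R : ℝ => u (circleMap 0 R t)) (𝓝[<] 1)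
      (𝓝 (u (Complex.exp (t * I)))) := by
    filter_upwards [hc] with t ht
    refine (hcont _ ht).tendsto.comp ?_
    have : ContinuousAt (fun R : ℝ => circleMap 0 R t) 1 := by
      unfold circleMap; fun_prop
    have h := this.tendsto
    rw [show circleMap 0 1 t = Complex.exp (t * I) by simp [circleMap]] at h
    exact h.mono_left nhdsWithin_le_nhds
  have hmeas : ∀ᶠ R : ℝ in 𝓝[<] 1, AEStronglyMeasurable (fun t => u (circleMap 0 R t)) μ :=
    hev.mono fun R hR => (hcirc R hR.1 hR.2).aestronglyMeasurable
  have htend := tendsto_integral_filter_of_dominated_convergence (fun _ => C) hmeas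
    (Eventually.of_forall fun R => Eventually.of_forall fun t => hbound _)
    (integrable_const _) hlim
  constructor
  · obtain ⟨v, hv⟩ := exists_seq_tendsto (𝓝[<] (1 : ℝ))
    obtain ⟨N, hN⟩ := (hv.eventually hmeas).exists_forall_of_atTop
    have hs : AEStronglyMeasurable (fun t : ℝ => u (Complex.exp (t * I))) μ :=
      aestronglyMeasurable_of_tendsto_ae atTop (f := fun n t => u (circleMap 0 (v (n + N)) t))
        (fun n => hN _ (Nat.le_add_left _ _))
        (hlim.mono fun t ht => (ht.comp hv).comp (tendsto_add_atTop_nat N))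
    exact Integrable.of_bound hs C (Eventually.of_forall fun t => hbound _)
  · refine ge_of_tendsto htend (hev.mono fun R hR => ?_)
    have hball : AnalyticOnNhd ℂ g (Metric.closedBall 0 |R|) := fun ζ hζ => hg ζ (by
      rw [mem_closedBall_zero_iff, abs_of_pos hR.1] at hζ
      exact hζ.trans_lt hR.2)
    have h1 := hball.log_norm_le_circleAverage hR.1.ne' h0
    have hcu : CircleIntegrable u 0 R := (hcirc R hR.1 hR.2).intervalIntegrable _ _
    -- `Real.log 0 = 0` exceeds `u` at the zeros of `g`, which form a discrete set.
    have hzero : (fun ζ => Real.log ‖g ζ‖) =ᶠ[codiscreteWithin (Metric.sphere 0 |R|)]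
        fun ζ => if g ζ = 0 then Real.log δ else Real.log ‖g ζ‖ := by
      have hconn : IsConnected (Metric.closedBall (0 : ℂ) |R|) :=
        ⟨Metric.nonempty_closedBall.2 (abs_nonneg R), (convex_closedBall 0 |R|).isPreconnected⟩
      filter_upwards [codiscreteWithin_mono Metric.sphere_subset_closedBall
        (hball.preimage_zero_mem_codiscreteWithin h0 (by simp) hconn)] with ζ hζ
      rw [if_neg (show g ζ ≠ 0 from hζ)]
    have h2 : Real.circleAverage (fun ζ => Real.log ‖g ζ‖) 0 R ≤ Real.circleAverage u 0 R := by
      rw [Real.circleAverage_congr_codiscreteWithin hzero hR.1.ne']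
      refine Real.circleAverage_mono ?_ hcu fun ζ hζ => ?_
      · exact CircleIntegrable.congr_codiscreteWithin hzero
          (MeromorphicOn.circleIntegrable_log_norm
            (hball.mono Metric.sphere_subset_closedBall).meromorphicOn)
      · split_ifs with h
        · exact Real.log_le_log hδ (le_max_right _ _)
        · exact Real.log_le_log (norm_pos_iff.2 h) (le_max_left _ _)
    have h3 := h1.trans h2
    rw [circleAverage_zero_eq_integral_Ioo u] at h3
    rwa [le_inv_mul_iff₀ (by positivity)] at h3

/-! ### Strip maps -/

/-- For `0 < α < π`, the conformal map of the unit disk onto the strip `0 < Im < 1` whose imaginary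
part is the harmonic measure of the arc `{exp (i t) : α < |t| ≤ π}`. With the principal branch of
the logarithm, the formula is analytic in the whole disk. -/
noncomputable def stripMap (α : ℝ) (ζ : ℂ) : ℂ :=
  (Complex.log (1 - ζ * Complex.exp (α * I)) - Complex.log (1 - ζ * Complex.exp (-α * I)) +
    (Real.pi - α) * I) / Real.pi

theorem one_sub_exp_mul_I (s : ℝ) :
    1 - Complex.exp (s * I) = ((2 * Real.sin (s / 2) : ℝ) : ℂ) *
      (Real.cos ((s - Real.pi) / 2) + Real.sin ((s - Real.pi) / 2) * I) := by
  have h1 : Real.cos ((s - Real.pi) / 2) = Real.sin (s / 2) := by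
    rw [sub_div, Real.cos_sub_pi_div_two]
  have h2 : Real.sin ((s - Real.pi) / 2) = -Real.cos (s / 2) := by
    rw [sub_div, Real.sin_sub_pi_div_two]
  have h3 : (s : ℂ) = 2 * ((s / 2 : ℝ) : ℂ) := by push_cast; ring
  rw [h1, h2, Complex.exp_mul_I, h3, Complex.cos_two_mul, Complex.sin_two_mul]
  have := Complex.sin_sq_add_cos_sq ((s / 2 : ℝ) : ℂ)
  push_cast at *
  linear_combination -2 * this

/-- The boundary values of the principal branch of `log (1 - ζ)`, for arguments in `(0, 2π)`. -/
theorem log_one_sub_exp_of_pos {s : ℝ} (h0 : 0 < s) (h1 : s < 2 * Real.pi) :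
    Complex.log (1 - Complex.exp (s * I)) =
      (Real.log (2 * Real.sin (s / 2)) : ℂ) + ((s - Real.pi) / 2 : ℝ) * I := by
  have hs : 0 < 2 * Real.sin (s / 2) :=
    mul_pos two_pos (Real.sin_pos_of_pos_of_lt_pi (by linarith) (by linarith))
  rw [one_sub_exp_mul_I]
  apply Complex.ext
  · rw [Complex.log_re, norm_mul, Complex.norm_real]
    rw [show ((Real.cos ((s - Real.pi) / 2) : ℂ) + Real.sin ((s - Real.pi) / 2) * I) =
      Complex.exp (((s - Real.pi) / 2 : ℝ) * I) by rw [Complex.exp_mul_I]; push_cast; rfl,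
      Complex.norm_exp_ofReal_mul_I, mul_one, Real.norm_of_nonneg hs.le]
    simp
  · rw [Complex.log_im, Complex.ofReal_cos, Complex.ofReal_sin,
      Complex.arg_mul_cos_add_sin_mul_I hs ⟨by linarith, by linarith⟩]
    simp

theorem log_one_sub_exp_of_neg {s : ℝ} (h0 : s < 0) (h1 : -(2 * Real.pi) < s) :
    Complex.log (1 - Complex.exp (s * I)) =
      (Real.log (2 * Real.sin (-s / 2)) : ℂ) + ((s + Real.pi) / 2 : ℝ) * I := by
  have := log_one_sub_exp_of_pos (s := s + 2 * Real.pi) (by linarith) (by linarith)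
  rw [show (((s + 2 * Real.pi : ℝ) : ℂ) * I) = s * I + 2 * Real.pi * I by push_cast; ring,
    Complex.exp_periodic] at this
  rw [this]
  rw [show (s + 2 * Real.pi) / 2 = s / 2 + Real.pi by ring, Real.sin_add_pi, neg_div,
    Real.sin_neg, show s + 2 * Real.pi - Real.pi = s + Real.pi by ring]

theorem stripMap_exp (α t : ℝ) :
    stripMap α (Complex.exp (t * I)) =
      (Complex.log (1 - Complex.exp ((t + α : ℝ) * I)) -
        Complex.log (1 - Complex.exp ((t - α : ℝ) * I)) + (Real.pi - α) * I) / Real.pi := by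
  unfold stripMap
  rw [← Complex.exp_add, ← Complex.exp_add]
  congr 6 <;> · push_cast; ring_nf

/-- The boundary values of `stripMap α` on the arc `|t| < α`. -/
noncomputable def stripArc (α t : ℝ) : ℝ :=
  (Real.log (Real.sin ((α + t) / 2)) - Real.log (Real.sin ((α - t) / 2))) / Real.pi

theorem stripMap_exp_of_abs_lt {α t : ℝ} (hα : α < Real.pi) (ht : |t| < α) :
    stripMap α (Complex.exp (t * I)) = stripArc α t := by
  obtain ⟨h1, h2⟩ := abs_lt.1 ht
  have e1 : 0 < Real.sin ((α + t) / 2) :=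
    Real.sin_pos_of_pos_of_lt_pi (by linarith) (by linarith)
  have e2 : 0 < Real.sin ((α - t) / 2) :=
    Real.sin_pos_of_pos_of_lt_pi (by linarith) (by linarith)
  rw [stripMap_exp, log_one_sub_exp_of_pos (by linarith) (by linarith),
    log_one_sub_exp_of_neg (by linarith) (by linarith), stripArc, neg_sub, add_comm t α,
    Real.log_mul two_ne_zero e1.ne', Real.log_mul two_ne_zero e2.ne']
  push_cast
  ring

theorem stripMap_exp_im_of_lt_abs {α t : ℝ} (hα0 : 0 < α) (ht : α < |t|)
    (ht' : |t| < Real.pi) : (stripMap α (Complex.exp (t * I))).im = 1 := by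
  have hpi := Real.pi_ne_zero
  rw [stripMap_exp, Complex.div_ofReal_im, div_eq_one_iff_eq hpi]
  rcases le_total 0 t with h | h
  · rw [abs_of_nonneg h] at ht ht'
    rw [log_one_sub_exp_of_pos (by linarith) (by linarith),
      log_one_sub_exp_of_pos (by linarith) (by linarith)]
    simp
    ring
  · rw [abs_of_nonpos h] at ht ht'
    rw [log_one_sub_exp_of_neg (by linarith) (by linarith),
      log_one_sub_exp_of_neg (by linarith) (by linarith)]
    simp
    ring

/-- A crude bound, valid in the whole plane because the argument lies in `(-π, π]`. -/
theorem abs_stripMap_im_le {α : ℝ} (hα0 : 0 ≤ α) (hα : α ≤ Real.pi) (ζ : ℂ) :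
    |(stripMap α ζ).im| ≤ 3 := by
  have hpi := Real.pi_pos
  rw [stripMap, Complex.div_ofReal_im, abs_div, abs_of_pos hpi, div_le_iff₀ hpi]
  have h1 := abs_le.1 (Complex.abs_arg_le_pi (1 - ζ * Complex.exp (α * I)))
  have h2 := abs_le.1 (Complex.abs_arg_le_pi (1 - ζ * Complex.exp (-α * I)))
  simp only [Complex.add_im, Complex.sub_im, Complex.log_im, Complex.mul_im, Complex.sub_re,
    Complex.ofReal_re, Complex.ofReal_im, Complex.I_re, Complex.I_im]
  rw [abs_le]
  constructor <;> linarith [h1.1, h1.2, h2.1, h2.2]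

theorem stripMap_zero (α : ℝ) : stripMap α 0 = ((1 - α / Real.pi : ℝ) : ℂ) * I := by
  have hpi : (Real.pi : ℂ) ≠ 0 := by exact_mod_cast Real.pi_ne_zero
  simp [stripMap]
  field_simp

theorem one_sub_mul_exp_mem_slitPlane {ζ : ℂ} (hζ : ‖ζ‖ ≤ 1) {s : ℝ}
    (h : ζ * Complex.exp (s * I) ≠ 1) : 1 - ζ * Complex.exp (s * I) ∈ Complex.slitPlane := by
  set v := ζ * Complex.exp (s * I) with hv
  have hv1 : ‖v‖ ≤ 1 := by rw [hv, norm_mul, Complex.norm_exp_ofReal_mul_I, mul_one]; exact hζ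
  left
  rw [Complex.sub_re, Complex.one_re, sub_pos]
  refine lt_of_le_of_ne ((Complex.re_le_norm v).trans hv1) fun hre => h ?_
  have hsq : v.re ^ 2 + v.im ^ 2 ≤ 1 := by
    have := Complex.sq_norm v
    rw [Complex.normSq_apply] at this
    nlinarith [norm_nonneg v]
  apply Complex.ext
  · simpa using hre
  · rw [hre] at hsq
    have : v.im = 0 := by nlinarith [sq_nonneg v.im]
    simpa using this

theorem analyticAt_stripMap {α : ℝ} {ζ : ℂ} (hζ : ‖ζ‖ ≤ 1)
    (h1 : ζ * Complex.exp (α * I) ≠ 1) (h2 : ζ * Complex.exp (-α * I) ≠ 1) :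
    AnalyticAt ℂ (stripMap α) ζ := by
  have m1 := one_sub_mul_exp_mem_slitPlane hζ h1
  have m2 := one_sub_mul_exp_mem_slitPlane (s := -α) hζ (by simpa using h2)
  rw [Complex.ofReal_neg] at m2
  unfold stripMap
  refine AnalyticAt.div ?_ analyticAt_const (by exact_mod_cast Real.pi_ne_zero)
  have a : ∀ c : ℂ, AnalyticAt ℂ (fun z : ℂ => 1 - z * c) ζ := fun c => by fun_prop
  exact (((a _).clog m1).sub ((a _).clog m2)).add analyticAt_const

theorem analyticAt_stripMap_of_norm_lt {α : ℝ} {ζ : ℂ} (hζ : ‖ζ‖ < 1) :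
    AnalyticAt ℂ (stripMap α) ζ := by
  have key : ∀ s : ℝ, ζ * Complex.exp (s * I) ≠ 1 := fun s hs => by
    have := congrArg norm hs
    rw [norm_mul, Complex.norm_exp_ofReal_mul_I, mul_one, norm_one] at this
    exact hζ.ne this
  exact analyticAt_stripMap hζ.le (key α) (by simpa using key (-α))

theorem analyticAt_stripMap_exp {α t : ℝ} (hα0 : 0 < α) (hα : α < Real.pi) (ht : |t| < Real.pi)
    (hne : |t| ≠ α) : AnalyticAt ℂ (stripMap α) (Complex.exp (t * I)) := by
  have key : ∀ s : ℝ, |s| < 2 * Real.pi → s ≠ 0 → Complex.exp (s * I) ≠ 1 := by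
    intro s hs hs0 h
    obtain ⟨n, hn⟩ := Complex.exp_eq_one_iff.1 h
    have h1 : (s : ℂ) = n * (2 * Real.pi) := by
      have : (s : ℂ) * I = (n * (2 * Real.pi)) * I := by rw [hn]; ring
      exact mul_right_cancel₀ Complex.I_ne_zero this
    have h2 : s = n * (2 * Real.pi) := by exact_mod_cast h1
    rw [h2, abs_mul, abs_of_pos Real.two_pi_pos] at hs
    have h3 : |(n : ℝ)| < 1 := by
      by_contra! hc
      nlinarith [Real.pi_pos]
    have h4 : n = 0 := by
      rw [← Int.cast_abs] at h3
      exact Int.abs_lt_one_iff.1 (by exact_mod_cast h3)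
    exact hs0 (by rw [h2, h4]; simp)
  obtain ⟨h1, h2⟩ := abs_lt.1 ht
  refine analyticAt_stripMap (by rw [Complex.norm_exp_ofReal_mul_I]) ?_ ?_
  · rw [← Complex.exp_add, ← add_mul, ← Complex.ofReal_add]
    refine key _ (abs_lt.2 ⟨by linarith, by linarith⟩) fun h => hne ?_
    rw [show t = -α by linarith, abs_neg, abs_of_pos hα0]
  · rw [← Complex.exp_add, ← add_mul, ← Complex.ofReal_neg, ← Complex.ofReal_add]
    refine key _ (abs_lt.2 ⟨by linarith, by linarith⟩) fun h => hne ?_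
    rw [show t = α by linarith, abs_of_pos hα0]

theorem hasDerivAt_stripArc {α t : ℝ} (hα : α < Real.pi) (ht : |t| < α) :
    HasDerivAt (stripArc α) (Real.sin α / (Real.cos t - Real.cos α) / Real.pi) t := by
  obtain ⟨h1, h2⟩ := abs_lt.1 ht
  have e1 : 0 < Real.sin ((α + t) / 2) :=
    Real.sin_pos_of_pos_of_lt_pi (by linarith) (by linarith)
  have e2 : 0 < Real.sin ((α - t) / 2) :=
    Real.sin_pos_of_pos_of_lt_pi (by linarith) (by linarith)
  have d1 : HasDerivAt (fun t => Real.log (Real.sin ((α + t) / 2)))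
      (Real.cos ((α + t) / 2) * (1 / 2) / Real.sin ((α + t) / 2)) t :=
    ((((hasDerivAt_id t).const_add α).div_const 2).sin).log e1.ne'
  have d2 : HasDerivAt (fun t => Real.log (Real.sin ((α - t) / 2)))
      (Real.cos ((α - t) / 2) * (-1 / 2) / Real.sin ((α - t) / 2)) t :=
    ((((hasDerivAt_id t).const_sub α).div_const 2).sin).log e2.ne'
  refine ((d1.sub d2).div_const Real.pi).congr_deriv ?_
  congr 1
  have e3 : Real.cos t - Real.cos α = 2 * Real.sin ((α + t) / 2) * Real.sin ((α - t) / 2) := by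
    rw [Real.cos_sub_cos, ← neg_sub α t, neg_div, Real.sin_neg, add_comm t α]; ring
  have e4 : Real.sin α = Real.sin ((α + t) / 2) * Real.cos ((α - t) / 2) +
      Real.cos ((α + t) / 2) * Real.sin ((α - t) / 2) := by
    rw [← Real.sin_add]; congr 1; ring
  rw [e3, e4]
  field_simp
  ring

theorem abs_stripArc_le {β t : ℝ} (hβ : 0 < β) (hβ1 : β ≤ 1) (ht : |t| < 1) :
    |stripArc (1 + β) t| ≤ Real.log (Real.pi / β) := by
  obtain ⟨h1, h2⟩ := abs_lt.1 ht
  have hpi := Real.pi_gt_three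
  have key : ∀ x, β / 2 ≤ x → x ≤ Real.pi / 2 →
      Real.log (Real.sin x) ≤ 0 ∧ -Real.log (Real.pi / β) ≤ Real.log (Real.sin x) := by
    intro x hx1 hx2
    have h := Real.mul_le_sin (by linarith : 0 ≤ x) hx2
    have h' : β / Real.pi ≤ Real.sin x := by
      refine le_trans ?_ h
      rw [div_mul_eq_mul_div]
      gcongr
      linarith
    have hp : 0 < β / Real.pi := by positivity
    refine ⟨Real.log_nonpos (hp.le.trans h') (Real.sin_le_one x), ?_⟩
    rw [← Real.log_inv, inv_div]
    exact Real.log_le_log hp h'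
  have k1 := key ((1 + β + t) / 2) (by linarith) (by linarith)
  have k2 := key ((1 + β - t) / 2) (by linarith) (by linarith)
  rw [stripArc, abs_div, abs_of_pos Real.pi_pos, div_le_iff₀ Real.pi_pos]
  have h0 : 0 ≤ Real.log (Real.pi / β) := by linarith
  have : |Real.log (Real.sin ((1 + β + t) / 2)) - Real.log (Real.sin ((1 + β - t) / 2))| ≤
      Real.log (Real.pi / β) := by
    rw [abs_le]; constructor <;> linarith
  nlinarith

theorem le_deriv_stripArc {α t : ℝ} (hα1 : 1 ≤ α) (hα : α ≤ 3 / 2) (ht : |t| < α) :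
    1 / 10 ≤ Real.sin α / (Real.cos t - Real.cos α) / Real.pi := by
  have hpi := Real.pi_gt_three
  have hpi4 := Real.pi_lt_d2
  have hs := Real.mul_le_sin (by linarith : 0 ≤ α) (by linarith)
  have hs' : 2 / Real.pi ≤ Real.sin α := le_trans (le_mul_of_one_le_right (by positivity) hα1) hs
  have hc : Real.cos α < Real.cos t := by
    rw [← Real.cos_abs t]
    exact Real.cos_lt_cos_of_nonneg_of_le_pi (abs_nonneg t) (by linarith) ht
  have hc2 : Real.cos t - Real.cos α ≤ 2 := by linarith [Real.cos_le_one t, Real.neg_one_le_cos α]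
  rw [div_div, le_div_iff₀ (mul_pos (sub_pos.2 hc) Real.pi_pos)]
  rw [div_le_iff₀ Real.pi_pos] at hs'
  have h2 : (Real.cos t - Real.cos α) * Real.pi ≤ 2 * Real.pi := by gcongr
  nlinarith

theorem deriv_stripArc_le {α t : ℝ} (hα1 : 1 ≤ α) (hα : α ≤ 3 / 2) (ht : |t| ≤ 1 / 2) :
    Real.sin α / (Real.cos t - Real.cos α) / Real.pi ≤ 3 := by
  have hpi := Real.pi_gt_three
  have hpi4 := Real.pi_lt_d2
  have h1 : Real.cos (1 / 2) ≤ Real.cos t := by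
    rw [← Real.cos_abs t]
    exact Real.cos_le_cos_of_nonneg_of_le_pi (abs_nonneg t) (by linarith) ht
  have h2 : Real.cos α ≤ Real.cos 1 :=
    Real.cos_le_cos_of_nonneg_of_le_pi zero_le_one (by linarith) hα1
  have h3 : 3 / (2 * Real.pi ^ 2) ≤ Real.cos (1 / 2) - Real.cos 1 := by
    rw [Real.cos_sub_cos, show ((1 / 2 - 1) / 2 : ℝ) = -(1 / 4) by norm_num, Real.sin_neg]
    have a1 := Real.mul_le_sin (x := (1 / 2 + 1) / 2) (by norm_num) (by linarith)
    have a2 := Real.mul_le_sin (x := 1 / 4) (by norm_num) (by linarith)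
    have a0 : 0 ≤ 2 / Real.pi * ((1 / 2 + 1) / 2) := by positivity
    calc 3 / (2 * Real.pi ^ 2)
        = 2 * (2 / Real.pi * ((1 / 2 + 1) / 2)) * (2 / Real.pi * (1 / 4)) := by field_simp; norm_num
      _ ≤ 2 * Real.sin ((1 / 2 + 1) / 2) * Real.sin (1 / 4) :=
        mul_le_mul (by linarith) a2 (by positivity) (by linarith)
      _ = _ := by ring
  have hp : 0 < 3 / (2 * Real.pi ^ 2) := by positivity
  rw [div_div, div_le_iff₀ (mul_pos (by linarith) Real.pi_pos)]
  have h4 : 3 / (2 * Real.pi ^ 2) * Real.pi ≤ (Real.cos t - Real.cos α) * Real.pi := by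
    gcongr
    linarith
  have h5 : 3 / (2 * Real.pi ^ 2) * Real.pi = 3 / (2 * Real.pi) := by field_simp
  have h6 : 1 / 3 ≤ 3 / (2 * Real.pi) := by rw [le_div_iff₀ (by positivity)]; linarith
  linarith [Real.sin_le_one α]

/-! ### Superpositions of strip maps -/

section

/-- Superpositions of the functions `stripMap`. -/
noncomputable def stripSum (s : Finset ℕ) (a α : ℕ → ℝ) (ζ : ℂ) : ℂ :=
  ∑ k ∈ s, (a k : ℂ) * stripMap (α k) ζ

/-- The boundary values of `stripSum s a α` on the arc `|t| < 1`, if all `α k` exceed `1`. -/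
noncomputable def stripSumArc (s : Finset ℕ) (a α : ℕ → ℝ) (t : ℝ) : ℝ :=
  ∑ k ∈ s, a k * stripArc (α k) t

variable {s : Finset ℕ} {a α : ℕ → ℝ}

theorem stripSum_exp_of_abs_lt (h2 : ∀ k ∈ s, α k ≤ 3 / 2) {t : ℝ} (ht : ∀ k ∈ s, |t| < α k) :
    stripSum s a α (Complex.exp (t * I)) = stripSumArc s a α t := by
  have hpi := Real.pi_gt_three
  rw [stripSum, stripSumArc, Complex.ofReal_sum]
  refine Finset.sum_congr rfl fun k hk => ?_
  rw [stripMap_exp_of_abs_lt (by linarith [h2 k hk]) (ht k hk), Complex.ofReal_mul]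

theorem stripSum_im (ζ : ℂ) : (stripSum s a α ζ).im = ∑ k ∈ s, a k * (stripMap (α k) ζ).im := by
  rw [stripSum, Complex.im_sum]
  exact Finset.sum_congr rfl fun k _ => Complex.im_ofReal_mul _ _

theorem le_stripSum_exp_im (ha : ∀ k ∈ s, 0 ≤ a k) (h1 : ∀ k ∈ s, 1 ≤ α k)
    (h2 : ∀ k ∈ s, α k ≤ 3 / 2) {t : ℝ} (ht : |t| < Real.pi) (hne : ∀ k ∈ s, |t| ≠ α k)
    {j : ℕ} (hj : j ∈ s) (hjt : α j < |t|) :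
    a j ≤ (stripSum s a α (Complex.exp (t * I))).im := by
  have hpi := Real.pi_gt_three
  have key : ∀ k ∈ s, α k < |t| → (stripMap (α k) (Complex.exp (t * I))).im = 1 := fun k hk h =>
    stripMap_exp_im_of_lt_abs (by linarith [h1 k hk]) h ht
  rw [stripSum_im]
  refine le_trans (by rw [key j hj hjt, mul_one])
    (Finset.single_le_sum (f := fun k => a k * (stripMap (α k) (Complex.exp (t * I))).im)
      (fun k hk => mul_nonneg (ha k hk) ?_) hj)
  rcases lt_or_gt_of_ne (hne k hk) with h | h
  · rw [stripMap_exp_of_abs_lt (by linarith [h2 k hk]) h, Complex.ofReal_im]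
  · rw [key k hk h]; exact zero_le_one

theorem abs_stripSum_im_le (ha : ∀ k ∈ s, 0 ≤ a k) (h1 : ∀ k ∈ s, 1 ≤ α k)
    (h2 : ∀ k ∈ s, α k ≤ 3 / 2) (hsum : ∑ k ∈ s, a k ≤ 2) (ζ : ℂ) :
    |(stripSum s a α ζ).im| ≤ 6 := by
  have hpi := Real.pi_gt_three
  rw [stripSum_im]
  calc |∑ k ∈ s, a k * (stripMap (α k) ζ).im| ≤ ∑ k ∈ s, |a k * (stripMap (α k) ζ).im| :=
        Finset.abs_sum_le_sum_abs _ _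
    _ ≤ ∑ k ∈ s, a k * 3 := by
        refine Finset.sum_le_sum fun k hk => ?_
        rw [abs_mul, abs_of_nonneg (ha k hk)]
        exact mul_le_mul_of_nonneg_left (abs_stripMap_im_le (by linarith [h1 k hk])
          (by linarith [h2 k hk]) ζ) (ha k hk)
    _ ≤ 6 := by rw [← Finset.sum_mul]; linarith

theorem le_stripSum_zero_im (ha : ∀ k ∈ s, 0 ≤ a k) (h2 : ∀ k ∈ s, α k ≤ 3 / 2) {j : ℕ}
    (hj : j ∈ s) : a j / 2 ≤ (stripSum s a α 0).im := by
  have hpi := Real.pi_gt_three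
  have key : ∀ k ∈ s, a k / 2 ≤ a k * (stripMap (α k) 0).im := by
    intro k hk
    rw [stripMap_zero, Complex.im_ofReal_mul, Complex.I_im, mul_one, div_eq_mul_one_div]
    have : α k / Real.pi ≤ 1 / 2 := by
      rw [div_le_iff₀ Real.pi_pos]; linarith [h2 k hk]
    exact mul_le_mul_of_nonneg_left (by linarith) (ha k hk)
  rw [stripSum_im]
  exact (key j hj).trans (Finset.single_le_sum (f := fun k => a k * (stripMap (α k) 0).im)
    (fun k hk => le_trans (by linarith [ha k hk]) (key k hk)) hj)

theorem analyticAt_stripSum {ζ : ℂ} (h : ∀ k ∈ s, AnalyticAt ℂ (stripMap (α k)) ζ) :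
    AnalyticAt ℂ (stripSum s a α) ζ :=
  Finset.analyticAt_fun_sum s fun k hk => analyticAt_const.mul (h k hk)

theorem hasDerivAt_stripSumArc (h1 : ∀ k ∈ s, 1 ≤ α k) (h2 : ∀ k ∈ s, α k ≤ 3 / 2) {t : ℝ}
    (ht : |t| < 1) : HasDerivAt (stripSumArc s a α)
      (∑ k ∈ s, a k * (Real.sin (α k) / (Real.cos t - Real.cos (α k)) / Real.pi)) t := by
  have hpi := Real.pi_gt_three
  exact HasDerivAt.fun_sum fun k hk => (hasDerivAt_stripArc (by linarith [h2 k hk])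
    (ht.trans_le (h1 k hk))).const_mul (a k)

theorem measurable_stripSumArc : Measurable (stripSumArc s a α) := by
  unfold stripSumArc stripArc
  fun_prop

theorem stripSumArc_zero : stripSumArc s a α 0 = 0 := by
  simp [stripSumArc, stripArc]

end

/-! ### Change of variables on the arc -/

theorem volume_image_eq_lintegral_of_deriv_pos {θ θ' : ℝ → ℝ}
    (hθ : ∀ t ∈ Ioo (-1 : ℝ) 1, HasDerivAt θ (θ' t) t) (hpos : ∀ t ∈ Ioo (-1 : ℝ) 1, 0 < θ' t)
    {T : Set ℝ} (hT : MeasurableSet T) (hT1 : T ⊆ Ioo (-1) 1) :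
    volume (θ '' T) = ∫⁻ t in T, ENNReal.ofReal (θ' t) := by
  refine (lintegral_deriv_eq_volume_image_of_monotoneOn hT
    (fun t ht => (hθ t (hT1 ht)).hasDerivWithinAt) (MonotoneOn.mono ?_ hT1)).symm
  refine (strictMonoOn_of_hasDerivWithinAt_pos (f' := θ') (convex_Ioo _ _)
    (fun t ht => (hθ t ht).continuousAt.continuousWithinAt) ?_ ?_).monotoneOn <;>
  rw [interior_Ioo]
  · exact fun t ht => (hθ t ht).hasDerivWithinAt
  · exact hpos

/-- A lower bound on the derivative bounds the density of the image of Lebesgue measure. -/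
theorem map_restrict_le_of_le_deriv {θ θ' : ℝ → ℝ} {c : ℝ} {J : Set ℝ} (hm : Measurable θ)
    (hθ : ∀ t ∈ Ioo (-1 : ℝ) 1, HasDerivAt θ (θ' t) t) (hc : 0 < c)
    (hle : ∀ t ∈ Ioo (-1 : ℝ) 1, c ≤ θ' t) (hJ : MapsTo θ (Ioo (-1) 1) J) :
    (volume.restrict (Ioo (-1 : ℝ) 1)).map θ ≤ ENNReal.ofReal c⁻¹ • volume.restrict J := by
  refine Measure.le_iff.2 fun s hs => ?_
  have hT : MeasurableSet (θ ⁻¹' s ∩ Ioo (-1) 1) := (hm hs).inter measurableSet_Ioo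
  rw [Measure.map_apply hm hs, Measure.restrict_apply (hm hs), Measure.smul_apply, smul_eq_mul,
    Measure.restrict_apply hs, ENNReal.ofReal_inv_of_pos hc, ← ENNReal.div_eq_inv_mul,
    ENNReal.le_div_iff_mul_le (Or.inl (by simpa using hc)) (Or.inl ENNReal.ofReal_ne_top)]
  calc volume (θ ⁻¹' s ∩ Ioo (-1) 1) * ENNReal.ofReal c
      = ∫⁻ t in θ ⁻¹' s ∩ Ioo (-1) 1, ENNReal.ofReal c := by rw [setLIntegral_const, mul_comm]
    _ ≤ ∫⁻ t in θ ⁻¹' s ∩ Ioo (-1) 1, ENNReal.ofReal (θ' t) :=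
        setLIntegral_mono' hT fun t ht => ENNReal.ofReal_le_ofReal (hle t ht.2)
    _ = volume (θ '' (θ ⁻¹' s ∩ Ioo (-1) 1)) :=
        (volume_image_eq_lintegral_of_deriv_pos hθ (fun t ht => hc.trans_le (hle t ht)) hT
          inter_subset_right).symm
    _ ≤ _ := by
        refine measure_mono ?_
        rintro _ ⟨t, ht, rfl⟩
        exact ⟨ht.1, hJ ht.2⟩

/-- An upper bound on the derivative prevents preimages from being too small. -/
theorem volume_inter_Ioo_le_mul_preimage {θ θ' : ℝ → ℝ} {c C x₀ : ℝ} {A : Set ℝ}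
    (hm : Measurable θ) (hθ : ∀ t ∈ Ioo (-1 : ℝ) 1, HasDerivAt θ (θ' t) t) (hc : 0 < c)
    (hle : ∀ t ∈ Ioo (-1 : ℝ) 1, c ≤ θ' t) (hC : ∀ t, |t| ≤ 1 / 2 → θ' t ≤ C)
    (h0 : θ 0 = x₀) (hA : MeasurableSet A) :
    volume (A ∩ Ioo (x₀ - c / 2) (x₀ + c / 2)) ≤
      ENNReal.ofReal C * volume (θ ⁻¹' A ∩ Ioo (-1) 1) := by
  have hsub : Icc (-(1 / 2) : ℝ) (1 / 2) ⊆ Ioo (-1) 1 := fun t ht =>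
    ⟨by linarith [ht.1], by linarith [ht.2]⟩
  have hcont : ContinuousOn θ (Ioo (-1) 1) := fun t ht => (hθ t ht).continuousAt.continuousWithinAt
  have hgrow : ∀ s ∈ Ioo (-1 : ℝ) 1, ∀ t ∈ Ioo (-1 : ℝ) 1, s ≤ t → c * (t - s) ≤ θ t - θ s := by
    refine Convex.mul_sub_le_image_sub_of_le_deriv (convex_Ioo _ _) hcont ?_ ?_ <;>
    rw [interior_Ioo]
    · exact fun t ht => (hθ t ht).differentiableAt.differentiableWithinAt
    · exact fun t ht => by rw [(hθ t ht).deriv]; exact hle t ht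
  have hr := hgrow 0 (by norm_num) (1 / 2) (by norm_num) (by norm_num)
  have hl := hgrow (-(1 / 2)) (by norm_num) 0 (by norm_num) (by norm_num)
  have hivt := intermediate_value_Icc (show (-(1 / 2) : ℝ) ≤ 1 / 2 by norm_num) (hcont.mono hsub)
  set T := θ ⁻¹' A ∩ Icc (-(1 / 2)) (1 / 2) with hT
  have hTm : MeasurableSet T := (hm hA).inter measurableSet_Icc
  calc volume (A ∩ Ioo (x₀ - c / 2) (x₀ + c / 2)) ≤ volume (θ '' T) := by
        refine measure_mono ?_
        rintro x ⟨hxA, hx⟩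
        have hxI : x ∈ Icc (θ (-(1 / 2))) (θ (1 / 2)) :=
          ⟨by linarith [hx.1], by linarith [hx.2]⟩
        obtain ⟨t, ht, rfl⟩ := hivt hxI
        exact ⟨t, ⟨hxA, ht⟩, rfl⟩
    _ = ∫⁻ t in T, ENNReal.ofReal (θ' t) :=
        volume_image_eq_lintegral_of_deriv_pos hθ (fun t ht => hc.trans_le (hle t ht)) hTm
          (inter_subset_right.trans hsub)
    _ ≤ ∫⁻ t in T, ENNReal.ofReal C :=
        setLIntegral_mono' hTm fun t ht => ENNReal.ofReal_le_ofReal (hC t (abs_le.2 ht.2))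
    _ = ENNReal.ofReal C * volume T := setLIntegral_const _ _
    _ ≤ _ := by
        gcongr
        exact inter_subset_inter_right _ hsub

/-! ### Point evaluations in the disk -/

theorem smul_restrict_ball_le_diskPart {G : ℝ → ℝ} (hG : MonotoneOn G (Icc 0 1)) {x : ℝ}
    (hx0 : 0 ≤ x) (hx1 : x ≤ 1) :
    ENNReal.ofReal (Real.pi⁻¹ * G x) • volume.restrict (Metric.ball (0 : ℂ) (1 - x)) ≤
      diskPart G := by
  rw [diskPart, ENNReal.ofReal_mul (by positivity), mul_smul]
  gcongr
  refine Measure.le_iff.2 fun s hs => ?_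
  rw [withDensity_apply _ hs, Measure.smul_apply, smul_eq_mul, Measure.restrict_apply hs,
    Measure.restrict_restrict hs, ← setLIntegral_const]
  refine (setLIntegral_mono' (hs.inter measurableSet_ball) fun z hz => ?_).trans
    (lintegral_mono_set (inter_subset_inter_right s (Metric.ball_subset_ball (by linarith))))
  have hz' := mem_ball_zero_iff.1 hz.2
  exact ENNReal.ofReal_le_ofReal
    (hG ⟨hx0, hx1⟩ ⟨by linarith, by linarith [norm_nonneg z]⟩ (by linarith))

/-- Point evaluations are bounded with respect to the norm of `L²(diskPart G)`. -/
theorem enorm_eval_sq_le_diskPart {G : ℝ → ℝ} (hG : MonotoneOn G (Icc 0 1)) (p : ℂ[X]) {z : ℂ}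
    {x : ℝ} (hx0 : 0 < x) (hx1 : x ≤ 1) (hz : ‖z‖ ≤ 1 - x) :
    ENNReal.ofReal (x ^ 2 / 4 * G (x / 2)) * ‖p.eval z‖ₑ ^ 2 ≤
      ∫⁻ ζ, ‖p.eval ζ‖ₑ ^ 2 ∂(diskPart G) := by
  have hpi := Real.pi_pos
  calc ENNReal.ofReal (x ^ 2 / 4 * G (x / 2)) * ‖p.eval z‖ₑ ^ 2
      = ENNReal.ofReal (Real.pi⁻¹ * G (x / 2)) *
        (ENNReal.ofReal (Real.pi * (x / 2) ^ 2) * ‖p.eval z‖ₑ ^ 2) := by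
        rw [← mul_assoc, ← ENNReal.ofReal_mul' (by positivity)]
        congr 2; field_simp; norm_num
    _ ≤ ENNReal.ofReal (Real.pi⁻¹ * G (x / 2)) *
        ∫⁻ ζ in Metric.ball z (x / 2), ‖p.eval ζ‖ₑ ^ 2 := by
        gcongr
        exact p.enorm_eval_sq_le_lintegral_ball z (by positivity)
    _ ≤ ENNReal.ofReal (Real.pi⁻¹ * G (x / 2)) *
        ∫⁻ ζ in Metric.ball 0 (1 - x / 2), ‖p.eval ζ‖ₑ ^ 2 := by
        gcongr
        exact Metric.ball_subset_ball' (by rw [dist_zero_right]; linarith)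
    _ = ∫⁻ ζ, ‖p.eval ζ‖ₑ ^ 2 ∂(ENNReal.ofReal (Real.pi⁻¹ * G (x / 2)) •
        volume.restrict (Metric.ball (0 : ℂ) (1 - x / 2))) := by
        rw [lintegral_smul_measure, smul_eq_mul]
    _ ≤ _ := lintegral_mono' (smul_restrict_ball_le_diskPart hG (by linarith) (by linarith)) le_rfl

/-! ### Dyadic form of the integrability of `log log (1 / G)` -/

/-- The value `log (1 / G (2 ^ (-k)))`. -/
noncomputable def logInv (G : ℝ → ℝ) (k : ℕ) : ℝ := Real.log (1 / G ((1 / 2) ^ k))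

theorem half_pow_mem_Ioo {k : ℕ} (hk : 1 ≤ k) : ((1 : ℝ) / 2) ^ k ∈ Ioo (0 : ℝ) 1 :=
  ⟨by positivity, pow_lt_one₀ (by norm_num) (by norm_num) (by omega)⟩

theorem logInv_pos {G : ℝ → ℝ} (hpos : ∀ x ∈ Ioo (0 : ℝ) 1, 0 < G x)
    (hlt : ∀ x ∈ Ioo (0 : ℝ) 1, G x < 1) {k : ℕ} (hk : 1 ≤ k) : 0 < logInv G k :=
  Real.log_pos (by
    have h := half_pow_mem_Ioo hk
    rw [one_lt_div (hpos _ h)]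
    exact hlt _ h)

/-- The dyadic form of the integrability of `log log (1 / G)`, by condensation. -/
theorem summable_posLog_logInv {G : ℝ → ℝ} (hmono : MonotoneOn G (Icc 0 1))
    (hpos : ∀ x ∈ Ioo (0 : ℝ) 1, 0 < G x) (hlt : ∀ x ∈ Ioo (0 : ℝ) 1, G x < 1)
    (hint : LogLogInt G) :
    Summable fun k : ℕ => ((1 : ℝ) / 2) ^ k * max 0 (Real.log (logInv G (k + 1))) := by
  set F : ℝ → ℝ≥0∞ := fun x => ENNReal.ofReal (Real.log (Real.log (1 / G x))) with hF
  set J : ℕ → Set ℝ := fun k => Ioo ((1 / 2) ^ (k + 2)) ((1 / 2) ^ (k + 1)) with hJ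
  have hJ01 : ∀ k, J k ⊆ Ioo 0 1 := fun k x hx =>
    ⟨(half_pow_mem_Ioo (by omega)).1.trans hx.1, hx.2.trans (half_pow_mem_Ioo (by omega)).2⟩
  have hdisj : Pairwise (Function.onFun Disjoint J) := by
    have key : ∀ m n : ℕ, m < n → Disjoint (J m) (J n) := by
      intro m n hmn
      refine Set.disjoint_left.2 fun x hx hy => ?_
      have : ((1 : ℝ) / 2) ^ (n + 1) ≤ (1 / 2) ^ (m + 2) :=
        pow_le_pow_of_le_one (by norm_num) (by norm_num) (by omega)
      exact absurd (hx.1.trans hy.2) (not_lt.2 this)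
    intro m n hmn
    rcases lt_or_gt_of_ne hmn with h | h
    · exact key m n h
    · exact (key n m h).symm
  have hle : ∀ k, ENNReal.ofReal (((1 : ℝ) / 2) ^ (k + 2) * max 0 (Real.log (logInv G (k + 1)))) ≤
      ∫⁻ x in J k, F x := by
    intro k
    have hk := half_pow_mem_Ioo (show 1 ≤ k + 1 by omega)
    calc _ = ∫⁻ x in J k, ENNReal.ofReal (Real.log (logInv G (k + 1))) := by
          rw [setLIntegral_const, hJ, Real.volume_Ioo, mul_comm,
            ENNReal.ofReal_mul (le_max_left _ _)]
          congr 1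
          · rw [max_comm, ENNReal.ofReal_max]; simp
          · congr 1; ring
      _ ≤ _ := by
          refine setLIntegral_mono' measurableSet_Ioo fun x hx => ENNReal.ofReal_le_ofReal ?_
          have hx01 := hJ01 k hx
          refine Real.log_le_log (logInv_pos hpos hlt (by omega)) ?_
          refine Real.log_le_log (one_div_pos.2 (hpos _ hk)) ?_
          refine one_div_le_one_div_of_le (hpos _ hx01) ?_
          exact hmono ⟨hx01.1.le, hx01.2.le⟩ ⟨hk.1.le, hk.2.le⟩ hx.2.le
  have hsum : ∑' k, ENNReal.ofReal
      (((1 : ℝ) / 2) ^ (k + 2) * max 0 (Real.log (logInv G (k + 1)))) ≠ ∞ := by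
    refine ne_top_of_le_ne_top hint.ne ((ENNReal.tsum_le_tsum hle).trans ?_)
    rw [← lintegral_iUnion (fun k => measurableSet_Ioo) hdisj]
    exact lintegral_mono_set (iUnion_subset hJ01)
  have h := ENNReal.summable_toReal hsum
  refine (h.mul_left 4).congr fun k => ?_
  rw [ENNReal.toReal_ofReal (by positivity), pow_add]
  ring

/-- The lengths by which the arcs in the construction of the analytic disk exceed the central
one. They are chosen so that `∑ 2⁻ᵏ log (1 / arcExcess k)` and
`∑ arcExcess (k - 1) * log (1 / G (2⁻ᵏ⁻²))` both converge. -/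
noncomputable def arcExcess (G : ℝ → ℝ) (k : ℕ) : ℝ :=
  (1 / 2) ^ (k + 1) / (1 + logInv G (k + 3))

theorem arcExcess_pos {G : ℝ → ℝ} (hpos : ∀ x ∈ Ioo (0 : ℝ) 1, 0 < G x)
    (hlt : ∀ x ∈ Ioo (0 : ℝ) 1, G x < 1) (k : ℕ) : 0 < arcExcess G k := by
  have := logInv_pos hpos hlt (show 1 ≤ k + 3 by omega)
  unfold arcExcess
  positivity

theorem arcExcess_le_pow {G : ℝ → ℝ} (hpos : ∀ x ∈ Ioo (0 : ℝ) 1, 0 < G x)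
    (hlt : ∀ x ∈ Ioo (0 : ℝ) 1, G x < 1) (k : ℕ) : arcExcess G k ≤ (1 / 2) ^ (k + 1) := by
  have := logInv_pos hpos hlt (show 1 ≤ k + 3 by omega)
  exact div_le_self (by positivity) (by linarith)

theorem arcExcess_le_half {G : ℝ → ℝ} (hpos : ∀ x ∈ Ioo (0 : ℝ) 1, 0 < G x)
    (hlt : ∀ x ∈ Ioo (0 : ℝ) 1, G x < 1) (k : ℕ) : arcExcess G k ≤ 1 / 2 := by
  refine (arcExcess_le_pow hpos hlt k).trans ?_
  simpa using pow_le_pow_of_le_one (show (0 : ℝ) ≤ 1 / 2 by norm_num) (by norm_num)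
    (show 1 ≤ k + 1 by omega)

theorem summable_log_arcExcess {G : ℝ → ℝ} (hpos : ∀ x ∈ Ioo (0 : ℝ) 1, 0 < G x)
    (hlt : ∀ x ∈ Ioo (0 : ℝ) 1, G x < 1) (hmono : MonotoneOn G (Icc 0 1)) (hint : LogLogInt G) :
    Summable fun k : ℕ => ((1 : ℝ) / 2) ^ k * Real.log (Real.pi / arcExcess G k) := by
  have h1 := summable_posLog_logInv hmono hpos hlt hint
  have h2 : Summable fun k : ℕ =>
      4 * (((1 : ℝ) / 2) ^ (k + 2) * max 0 (Real.log (logInv G (k + 2 + 1)))) :=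
    ((summable_nat_add_iff 2).2 h1).mul_left 4
  have h3 : Summable fun k : ℕ => (k : ℝ) ^ 1 * ((1 : ℝ) / 2) ^ k :=
    summable_pow_mul_geometric_of_norm_lt_one 1 (by norm_num)
  have h4 : Summable fun k : ℕ => ((1 : ℝ) / 2) ^ k := summable_geometric_two
  refine Summable.of_nonneg_of_le (fun k => ?_) (fun k => ?_)
    ((h2.add (h3.mul_right (Real.log 2))).add (h4.mul_right (Real.log Real.pi + 2 * Real.log 2)))
  · refine mul_nonneg (by positivity) (Real.log_nonneg ?_)
    rw [one_le_div (arcExcess_pos hpos hlt k)]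
    linarith [arcExcess_le_half hpos hlt k, Real.pi_gt_three]
  · have hL := logInv_pos hpos hlt (show 1 ≤ k + 3 by omega)
    have e1 : Real.log (Real.pi / arcExcess G k) =
        Real.log Real.pi + (k + 1) * Real.log 2 + Real.log (1 + logInv G (k + 3)) := by
      have : Real.pi / arcExcess G k = Real.pi * 2 ^ (k + 1) * (1 + logInv G (k + 3)) := by
        unfold arcExcess
        rw [one_div, inv_pow]
        field_simp
      rw [this, Real.log_mul (by positivity) (by positivity),
        Real.log_mul Real.pi_ne_zero (by positivity), Real.log_pow]
      push_cast; ring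
    have e2 : Real.log (1 + logInv G (k + 3)) ≤
        Real.log 2 + max 0 (Real.log (logInv G (k + 3))) := by
      have : 1 + logInv G (k + 3) ≤ 2 * max 1 (logInv G (k + 3)) := by
        linarith [le_max_left 1 (logInv G (k + 3)), le_max_right 1 (logInv G (k + 3))]
      refine (Real.log_le_log (by positivity) this).trans ?_
      rw [Real.log_mul two_ne_zero (by positivity)]
      gcongr
      rcases le_total 1 (logInv G (k + 3)) with h | h
      · rw [max_eq_right h]; exact le_max_right _ _
      · rw [max_eq_left h]; simp
    rw [e1]
    calc _ ≤ ((1 : ℝ) / 2) ^ k * (Real.log Real.pi + (k + 1) * Real.log 2 +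
          (Real.log 2 + max 0 (Real.log (logInv G (k + 3))))) := by gcongr
      _ = _ := by rw [pow_add]; ring

theorem sum_arcExcess_mul_le {G : ℝ → ℝ} (hpos : ∀ x ∈ Ioo (0 : ℝ) 1, 0 < G x)
    (hlt : ∀ x ∈ Ioo (0 : ℝ) 1, G x < 1) (K N : ℕ) :
    ∑ k ∈ Finset.Ioc K N, arcExcess G (k - 1) * (k + 3 + logInv G (k + 2)) ≤
      ∑' k : ℕ, ((1 : ℝ) / 2) ^ k * (k + 4) := by
  have h3 : Summable fun k : ℕ => (k : ℝ) ^ 1 * ((1 : ℝ) / 2) ^ k :=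
    summable_pow_mul_geometric_of_norm_lt_one 1 (by norm_num)
  have h4 : Summable fun k : ℕ => ((1 : ℝ) / 2) ^ k := summable_geometric_two
  have hs : Summable fun k : ℕ => ((1 : ℝ) / 2) ^ k * (k + 4) :=
    (h3.add (h4.mul_right 4)).congr fun k => by ring
  refine le_trans (Finset.sum_le_sum fun k hk => ?_)
    (hs.sum_le_tsum (Finset.Ioc K N) fun k _ => by positivity)
  obtain ⟨n, rfl⟩ : ∃ n, k = n + 1 := ⟨k - 1, by have := (Finset.mem_Ioc.1 hk).1; omega⟩
  have hL := logInv_pos hpos hlt (show 1 ≤ n + 3 by omega)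
  rw [Nat.add_sub_cancel, arcExcess, div_mul_eq_mul_div, div_le_iff₀ (by positivity), mul_assoc]
  gcongr
  rw [show n + 1 + 2 = n + 3 by omega]
  have : (0 : ℝ) ≤ n := n.cast_nonneg
  push_cast
  nlinarith

/-! ### Upper bounds for logarithms -/

/-- A bound for `log Q`, truncated at `log √σ`, in terms of a weight `W`. The term `log σ / 2` comes
from `log y ≤ y / σ + log σ`, applied to `y = W Q ^ 2`. -/
theorem log_max_sqrt_le_of_le {W v σ Q : ℝ} (hW : 0 < W) (hσ : 0 < σ) (hQ : 0 ≤ Q) (hQv : Q ≤ v) :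
    Real.log (max Q √σ) ≤
      2 * W + W * v ^ 2 / σ + 1 / 2 * |Real.log W| + 1 / 2 * Real.log σ := by
  have hs := Real.sqrt_pos.2 hσ
  have hM : 0 < max Q √σ := lt_max_of_lt_right hs
  have hsq : (max Q √σ) ^ 2 ≤ v ^ 2 + σ := by
    rcases max_choice Q √σ with h | h <;> rw [h]
    · linarith [pow_le_pow_left₀ hQ hQv 2]
    · rw [Real.sq_sqrt hσ.le]; nlinarith [sq_nonneg v]
  set y := max Q √σ
  have h1 : Real.log (W * y ^ 2 / σ) = Real.log W + 2 * Real.log y - Real.log σ := by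
    rw [Real.log_div (by positivity) hσ.ne', Real.log_mul hW.ne' (by positivity), Real.log_pow]
    push_cast; ring
  have h2 : Real.log (W * y ^ 2 / σ) ≤ W * y ^ 2 / σ - 1 :=
    Real.log_le_sub_one_of_pos (by positivity)
  have h3 : W * y ^ 2 / σ ≤ W * v ^ 2 / σ + W := by
    rw [div_add' _ _ _ hσ.ne']
    gcongr
    nlinarith
  have h4 : 0 ≤ W * v ^ 2 / σ := by positivity
  linarith [neg_abs_le (Real.log W)]

/-- The form of `log_max_sqrt_le_of_le` in which `Q` is not small: there is no gain. -/
theorem log_max_sqrt_le_of_le_one_add {W v σ Q : ℝ} (hW : 0 < W) (hσ : 0 < σ) (hσ1 : σ ≤ 1)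
    (hv : 0 ≤ v) (hQv : Q ≤ 1 + v) :
    Real.log (max Q √σ) ≤ 2 * W + W * v ^ 2 / σ + 1 / 2 * |Real.log W| := by
  have hM : 0 < max Q √σ := lt_max_of_lt_right (Real.sqrt_pos.2 hσ)
  have hle : max Q √σ ≤ 1 + v :=
    max_le hQv (by linarith [Real.sqrt_le_one.2 hσ1])
  set y := max Q √σ
  have h1 : Real.log (W * y ^ 2) = Real.log W + 2 * Real.log y := by
    rw [Real.log_mul hW.ne' (by positivity), Real.log_pow]
    push_cast; ring
  have h2 : Real.log (W * y ^ 2) ≤ W * y ^ 2 - 1 := Real.log_le_sub_one_of_pos (by positivity)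
  have h3 : W * y ^ 2 ≤ 2 * W + 2 * (W * v ^ 2) := by
    have : y ^ 2 ≤ 2 + 2 * v ^ 2 := by nlinarith [sq_nonneg (1 - v)]
    nlinarith
  have h4 : W * v ^ 2 ≤ W * v ^ 2 / σ := le_div_self (by positivity) hσ hσ1
  linarith [neg_abs_le (Real.log W)]

theorem integral_comp_le_of_map_le {μ : Measure ℝ} {J : Set ℝ} {θ X : ℝ → ℝ} {c : ℝ} (hc : 0 ≤ c)
    (hm : Measurable θ) (hmap : μ.map θ ≤ ENNReal.ofReal c • volume.restrict J)
    (hX : IntegrableOn X J) (hX0 : ∀ᵐ s ∂volume.restrict J, 0 ≤ X s) :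
    Integrable (fun t => X (θ t)) μ ∧ ∫ t, X (θ t) ∂μ ≤ c * ∫ s in J, X s := by
  have h1 : Integrable X (ENNReal.ofReal c • volume.restrict J) :=
    Integrable.smul_measure hX ENNReal.ofReal_ne_top
  have h2 : Integrable X (μ.map θ) := h1.mono_measure hmap
  refine ⟨h2.comp_measurable hm, ?_⟩
  rw [← integral_map hm.aemeasurable h2.aestronglyMeasurable]
  refine (integral_mono_measure hmap (Measure.ae_smul_measure hX0 _) h1).trans_eq ?_
  rw [integral_smul_measure, ENNReal.toReal_ofReal hc, smul_eq_mul]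

/-- The two arcs `1 < |t| < b`. -/
def arcPair (b : ℝ) : Set ℝ := {t | 1 < |t| ∧ |t| < b}

theorem measurableSet_arcPair (b : ℝ) : MeasurableSet (arcPair b) := by
  unfold arcPair
  measurability

theorem integral_indicator_arcPair_le {b D : ℝ} (hb : 1 ≤ b) (hD : 0 ≤ D) (T : Set ℝ) :
    ∫ t in T, (arcPair b).indicator (fun _ => D) t ≤ 2 * (b - 1) * D := by
  have hsub : arcPair b ⊆ Ioo (-b) (-1) ∪ Ioo 1 b := by
    rintro t ⟨h1, h2⟩
    rcases le_total 0 t with h | h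
    · rw [abs_of_nonneg h] at h1 h2; exact Or.inr ⟨h1, h2⟩
    · rw [abs_of_nonpos h] at h1 h2; exact Or.inl ⟨by linarith, by linarith⟩
  have hvol : volume (arcPair b) ≤ ENNReal.ofReal (2 * (b - 1)) := by
    refine (measure_mono hsub).trans ((measure_union_le _ _).trans ?_)
    rw [Real.volume_Ioo, Real.volume_Ioo, ← ENNReal.ofReal_add (by linarith) (by linarith)]
    exact ENNReal.ofReal_le_ofReal (by linarith)
  rw [integral_indicator (measurableSet_arcPair b), setIntegral_const, smul_eq_mul]
  gcongr
  refine ENNReal.toReal_le_of_le_ofReal (by linarith) (le_trans ?_ hvol)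
  exact Measure.restrict_le_self _

theorem norm_eval_sq_le {G : ℝ → ℝ} (hG : MonotoneOn G (Icc 0 1)) {p : ℂ[X]} {z : ℂ}
    {x E : ℝ} (hx0 : 0 < x) (hx1 : x ≤ 1) (hz : ‖z‖ ≤ 1 - x) (hE : 0 ≤ E)
    (hp : ∫⁻ ζ, ‖p.eval ζ‖ₑ ^ 2 ∂(diskPart G) ≤ ENNReal.ofReal E) :
    x ^ 2 / 4 * G (x / 2) * ‖p.eval z‖ ^ 2 ≤ E := by
  have h := (enorm_eval_sq_le_diskPart hG p hx0 hx1 hz).trans hp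
  rw [← ofReal_norm, ← ENNReal.ofReal_pow (norm_nonneg _),
    ← ENNReal.ofReal_mul' (by positivity)] at h
  exact (ENNReal.ofReal_le_ofReal_iff hE).1 h

/-- The bound on `1 - p` that the norm of `p` in `L²(diskPart G)` gives. -/
theorem log_max_norm_one_sub_eval_le {G : ℝ → ℝ} (hG : MonotoneOn G (Icc 0 1))
    (hpos : ∀ x ∈ Ioo (0 : ℝ) 1, 0 < G x) (hlt : ∀ x ∈ Ioo (0 : ℝ) 1, G x < 1) {p : ℂ[X]} {z : ℂ}
    {k : ℕ} {δ : ℝ} (hδ : 0 < δ) (hδ1 : δ ≤ 1) (hz : ‖z‖ ≤ 1 - (1 / 2) ^ (k + 1))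
    (hp : ∫⁻ ζ, ‖p.eval ζ‖ₑ ^ 2 ∂(diskPart G) ≤ 1) :
    Real.log (max ‖(1 - p).eval z‖ δ) ≤ k + 3 + logInv G (k + 2) := by
  have hL := logInv_pos hpos hlt (show 1 ≤ k + 2 by omega)
  have hg := hpos _ (half_pow_mem_Ioo (show 1 ≤ k + 2 by omega))
  have h := norm_eval_sq_le (E := 1) hG (by positivity) (half_pow_mem_Ioo (by omega)).2.le hz
    zero_le_one (by rwa [ENNReal.ofReal_one])
  have hexp : Real.exp (logInv G (k + 2)) = 1 / G ((1 / 2) ^ (k + 2)) :=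
    Real.exp_log (one_div_pos.2 hg)
  have e1 : 1 ≤ Real.exp (logInv G (k + 2)) := Real.one_le_exp hL.le
  rw [show ((1 : ℝ) / 2) ^ (k + 1) / 2 = (1 / 2) ^ (k + 2) by ring] at h
  have h1 : ‖p.eval z‖ ^ 2 ≤ (2 ^ (k + 2) * Real.exp (logInv G (k + 2))) ^ 2 := by
    calc ‖p.eval z‖ ^ 2 ≤ (2 ^ (k + 2)) ^ 2 * Real.exp (logInv G (k + 2)) := by
          rw [hexp, mul_one_div, le_div_iff₀ hg]
          have e2 : (((1 : ℝ) / 2) ^ (k + 1)) ^ 2 / 4 = ((2 ^ (k + 2)) ^ 2)⁻¹ := by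
            rw [one_div, inv_pow]; field_simp; ring
          rw [e2, mul_assoc, inv_mul_le_iff₀ (by positivity), mul_one] at h
          linarith
      _ ≤ _ := by
          rw [mul_pow]
          gcongr
          nlinarith
  have h2 : ‖p.eval z‖ ≤ 2 ^ (k + 2) * Real.exp (logInv G (k + 2)) :=
    (pow_le_pow_iff_left₀ (norm_nonneg _) (by positivity) two_ne_zero).1 h1
  have e3 : (1 : ℝ) ≤ 2 ^ (k + 2) := one_le_pow₀ one_le_two
  have h3 : max ‖(1 - p).eval z‖ δ ≤ 2 ^ (k + 3) * Real.exp (logInv G (k + 2)) := by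
    have e4 : 1 ≤ 2 ^ (k + 2) * Real.exp (logInv G (k + 2)) := one_le_mul_of_one_le_of_one_le e3 e1
    have e5 : ‖(1 - p).eval z‖ ≤ 1 + ‖p.eval z‖ := by
      rw [eval_sub, eval_one]
      exact (norm_sub_le _ _).trans (by simp)
    have e6 : (2 : ℝ) ^ (k + 3) = 2 * 2 ^ (k + 2) := by ring
    rw [e6]
    exact max_le (by linarith) (by linarith)
  calc _ ≤ Real.log (2 ^ (k + 3) * Real.exp (logInv G (k + 2))) :=
        Real.log_le_log (lt_max_of_lt_right hδ) h3
    _ = (k + 3) * Real.log 2 + logInv G (k + 2) := by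
        rw [Real.log_mul (by positivity) (Real.exp_ne_zero _), Real.log_pow, Real.log_exp]
        push_cast; ring
    _ ≤ _ := by
        have : Real.log 2 ≤ 1 := by linarith [Real.log_two_lt_d9]
        have hk : (0 : ℝ) ≤ k := k.cast_nonneg
        nlinarith

/-! ### Attached analytic disks -/

/-- The arcs `|t| < arcEnd G k` decrease to `|t| < 1`; the strip map of the arc number `k` gets the
coefficient `2⁻ᵏ`. -/
noncomputable def arcEnd (G : ℝ → ℝ) (k : ℕ) : ℝ := 1 + arcExcess G k

/-- The pointwise upper bound for `log ‖1 - p‖` along the boundary of the attached disk: `f` on the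
arc `|t| < 1`, the constant `b`, a bound for `log ‖1 - p‖` on the unit circle, on the arcs that are
mapped into the circle beside it, and the bounds which come from point evaluations elsewhere. All
summands other than that with `f` are nonnegative if `b` is, so that an upper bound by one of them
suffices. -/
noncomputable def discMajorant (G : ℝ → ℝ) (f : ℝ → ℝ) (b : ℝ) (K N : ℕ) (t : ℝ) : ℝ :=
  (Ioo (-1 : ℝ) 1).indicator f t + (arcPair (arcEnd G N)).indicator (fun _ => b) t +
    (K + 3 + logInv G (K + 2)) +
    ∑ k ∈ Finset.Ioc K N, (arcPair (arcEnd G (k - 1))).indicator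
      (fun _ => k + 3 + logInv G (k + 2)) t

theorem integral_discMajorant_le {G : ℝ → ℝ} (hpos : ∀ x ∈ Ioo (0 : ℝ) 1, 0 < G x)
    (hlt : ∀ x ∈ Ioo (0 : ℝ) 1, G x < 1) {f : ℝ → ℝ} (hf : IntegrableOn f (Ioo (-1) 1)) {b : ℝ}
    (hb : 0 ≤ b) (K N : ℕ) :
    IntegrableOn (discMajorant G f b K N) (Ioo (-Real.pi) Real.pi) ∧
    ∫ t in Ioo (-Real.pi) Real.pi, discMajorant G f b K N t ≤
      (∫ t in Ioo (-1) 1, f t) + 2 * arcExcess G N * b +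
        2 * Real.pi * (K + 3 + logInv G (K + 2)) + 2 * ∑' k : ℕ, ((1 : ℝ) / 2) ^ k * (k + 4) := by
  have hpi := Real.pi_gt_three
  have hD : ∀ k : ℕ, 0 ≤ k + 3 + logInv G (k + 2) := fun k => by
    have := logInv_pos hpos hlt (show 1 ≤ k + 2 by omega)
    positivity
  have i1 : IntegrableOn ((Ioo (-1 : ℝ) 1).indicator f) (Ioo (-Real.pi) Real.pi) :=
    ((integrable_indicator_iff measurableSet_Ioo).2 hf).integrableOn
  have i2 : ∀ c D : ℝ, IntegrableOn ((arcPair c).indicator fun _ => D) (Ioo (-Real.pi) Real.pi) :=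
    fun c D => (integrable_const D).indicator (measurableSet_arcPair c)
  have i3 : IntegrableOn (fun _ : ℝ => K + 3 + logInv G (K + 2)) (Ioo (-Real.pi) Real.pi) :=
    integrable_const _
  have i4 : IntegrableOn (fun t => ∑ k ∈ Finset.Ioc K N,
      (arcPair (arcEnd G (k - 1))).indicator (fun _ => k + 3 + logInv G (k + 2)) t)
      (Ioo (-Real.pi) Real.pi) := integrable_finsetSum _ fun k _ => i2 _ _
  have i12 : IntegrableOn (fun t => (Ioo (-1 : ℝ) 1).indicator f t +
      (arcPair (arcEnd G N)).indicator (fun _ => b) t) (Ioo (-Real.pi) Real.pi) :=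
    i1.add (i2 _ _)
  have i123 : IntegrableOn (fun t => (Ioo (-1 : ℝ) 1).indicator f t +
      (arcPair (arcEnd G N)).indicator (fun _ => b) t + (K + 3 + logInv G (K + 2)))
      (Ioo (-Real.pi) Real.pi) := i12.add i3
  refine ⟨i123.add i4, ?_⟩
  unfold discMajorant
  rw [integral_add i123 i4, integral_add i12 i3, integral_add i1 (i2 _ _),
    integral_finsetSum _ fun k _ => i2 _ _,
    setIntegral_indicator measurableSet_Ioo, setIntegral_const,
    inter_eq_right.2 (Ioo_subset_Ioo (by linarith) (by linarith) :
      Ioo (-1 : ℝ) 1 ⊆ Ioo (-Real.pi) Real.pi), Real.volume_real_Ioo_of_le (by linarith),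
    smul_eq_mul]
  gcongr ?_ + ?_ + ?_ + ?_
  · exact le_rfl
  · refine (integral_indicator_arcPair_le ?_ hb _).trans_eq (by rw [arcEnd]; ring)
    exact (lt_add_of_pos_right 1 (arcExcess_pos hpos hlt N)).le
  · exact le_of_eq (by ring)
  · refine le_trans (Finset.sum_le_sum fun k _ => integral_indicator_arcPair_le ?_ (hD k) _) ?_
    · exact (lt_add_of_pos_right 1 (arcExcess_pos hpos hlt (k - 1))).le
    · refine le_trans (le_of_eq ?_)
        (mul_le_mul_of_nonneg_left (sum_arcExcess_mul_le hpos hlt K N) two_pos.le)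
      rw [Finset.mul_sum]
      exact Finset.sum_congr rfl fun k _ => by rw [arcEnd]; ring

/-- The analytic disk attached to the unit circle near `exp (i x₀)`: the image of the arc `|t| < 1`
lies on the circle, and the points with `|t| > arcEnd G k` for some `k` between `K` and `N` are
mapped into the open disk. -/
noncomputable def attachedDisk (G : ℝ → ℝ) (x₀ : ℝ) (K N : ℕ) (ζ : ℂ) : ℂ :=
  Complex.exp ((x₀ + stripSum (Finset.Icc K N) (fun k => (1 / 2) ^ k) (arcEnd G) ζ) * I)

/-- The argument of the boundary values of `attachedDisk` on the arc `|t| < 1`. -/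
noncomputable def attachedArc (G : ℝ → ℝ) (x₀ : ℝ) (K N : ℕ) (t : ℝ) : ℝ :=
  x₀ + stripSumArc (Finset.Icc K N) (fun k => (1 / 2) ^ k) (arcEnd G) t

theorem norm_attachedDisk (G : ℝ → ℝ) (x₀ : ℝ) (K N : ℕ) (ζ : ℂ) :
    ‖attachedDisk G x₀ K N ζ‖ =
      Real.exp (-(stripSum (Finset.Icc K N) (fun k => (1 / 2) ^ k) (arcEnd G) ζ).im) := by
  rw [attachedDisk, Complex.norm_exp]
  simp

theorem sum_Icc_half_pow_le (K N : ℕ) : ∑ k ∈ Finset.Icc K N, ((1 : ℝ) / 2) ^ k ≤ 2 := by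
  exact (summable_geometric_two.sum_le_tsum _ fun k _ => by positivity).trans_eq tsum_geometric_two

theorem exp_neg_half_pow_le (k : ℕ) : Real.exp (-(1 / 2) ^ k) ≤ 1 - (1 / 2) ^ (k + 1) := by
  have h0 : (0 : ℝ) < (1 / 2) ^ k := by positivity
  have h1 : ((1 : ℝ) / 2) ^ k ≤ 1 := pow_le_one₀ (by norm_num) (by norm_num)
  rw [Real.exp_neg, pow_succ]
  refine (inv_anti₀ (by linarith) (Real.add_one_le_exp ((1 / 2 : ℝ) ^ k))).trans ?_
  rw [inv_le_iff_one_le_mul₀ (by linarith)]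
  nlinarith

theorem one_lt_arcEnd {G : ℝ → ℝ} (hpos : ∀ x ∈ Ioo (0 : ℝ) 1, 0 < G x)
    (hlt : ∀ x ∈ Ioo (0 : ℝ) 1, G x < 1) (k : ℕ) : 1 < arcEnd G k := by
  have := arcExcess_pos hpos hlt k
  unfold arcEnd; linarith

theorem arcEnd_le {G : ℝ → ℝ} (hpos : ∀ x ∈ Ioo (0 : ℝ) 1, 0 < G x)
    (hlt : ∀ x ∈ Ioo (0 : ℝ) 1, G x < 1) (k : ℕ) : arcEnd G k ≤ 3 / 2 := by
  have := arcExcess_le_half hpos hlt k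
  unfold arcEnd; linarith

theorem norm_attachedDisk_le {G : ℝ → ℝ} (hpos : ∀ x ∈ Ioo (0 : ℝ) 1, 0 < G x)
    (hlt : ∀ x ∈ Ioo (0 : ℝ) 1, G x < 1) (x₀ : ℝ) (K N : ℕ) (ζ : ℂ) :
    ‖attachedDisk G x₀ K N ζ‖ ≤ Real.exp 6 := by
  rw [norm_attachedDisk]
  have := abs_le.1 (abs_stripSum_im_le (s := Finset.Icc K N) (a := fun k => (1 / 2) ^ k)
    (fun k _ => by positivity) (fun k _ => (one_lt_arcEnd hpos hlt k).le)
    (fun k _ => arcEnd_le hpos hlt k) (sum_Icc_half_pow_le K N) ζ)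
  exact Real.exp_le_exp.2 (by linarith [this.1])

theorem norm_attachedDisk_zero_le {G : ℝ → ℝ} (hpos : ∀ x ∈ Ioo (0 : ℝ) 1, 0 < G x)
    (hlt : ∀ x ∈ Ioo (0 : ℝ) 1, G x < 1) (x₀ : ℝ) {K N : ℕ} (hKN : K ≤ N) :
    ‖attachedDisk G x₀ K N 0‖ ≤ 1 - (1 / 2) ^ (K + 2) := by
  rw [norm_attachedDisk]
  have := le_stripSum_zero_im (s := Finset.Icc K N) (a := fun k => ((1 : ℝ) / 2) ^ k)
    (fun k _ => by positivity) (fun k _ => arcEnd_le hpos hlt k) (Finset.left_mem_Icc.2 hKN)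
  refine le_trans (Real.exp_le_exp.2 ?_) (exp_neg_half_pow_le (K + 1))
  rw [pow_succ]
  linarith

theorem attachedDisk_exp_of_abs_lt {G : ℝ → ℝ} (hpos : ∀ x ∈ Ioo (0 : ℝ) 1, 0 < G x)
    (hlt : ∀ x ∈ Ioo (0 : ℝ) 1, G x < 1) (x₀ : ℝ) (K N : ℕ) {t : ℝ} (ht : |t| < 1) :
    attachedDisk G x₀ K N (Complex.exp (t * I)) = Complex.exp (attachedArc G x₀ K N t * I) := by
  rw [attachedDisk, attachedArc, stripSum_exp_of_abs_lt (fun k _ => arcEnd_le hpos hlt k)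
    (fun k _ => ht.trans (one_lt_arcEnd hpos hlt k))]
  push_cast
  rfl

theorem norm_attachedDisk_exp_of_abs_lt {G : ℝ → ℝ} (hpos : ∀ x ∈ Ioo (0 : ℝ) 1, 0 < G x)
    (hlt : ∀ x ∈ Ioo (0 : ℝ) 1, G x < 1) (x₀ : ℝ) (K N : ℕ) {t : ℝ}
    (ht : ∀ k ∈ Finset.Icc K N, |t| < arcEnd G k) :
    ‖attachedDisk G x₀ K N (Complex.exp (t * I))‖ = 1 := by
  rw [norm_attachedDisk, stripSum_exp_of_abs_lt (fun k _ => arcEnd_le hpos hlt k) ht,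
    Complex.ofReal_im, neg_zero, Real.exp_zero]

theorem norm_attachedDisk_exp_le {G : ℝ → ℝ} (hpos : ∀ x ∈ Ioo (0 : ℝ) 1, 0 < G x)
    (hlt : ∀ x ∈ Ioo (0 : ℝ) 1, G x < 1) (x₀ : ℝ) {K N j : ℕ} {t : ℝ} (ht : |t| < Real.pi)
    (hne : ∀ k ∈ Finset.Icc K N, |t| ≠ arcEnd G k) (hj : j ∈ Finset.Icc K N)
    (hjt : arcEnd G j < |t|) :
    ‖attachedDisk G x₀ K N (Complex.exp (t * I))‖ ≤ 1 - (1 / 2) ^ (j + 1) := by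
  rw [norm_attachedDisk]
  have := le_stripSum_exp_im (s := Finset.Icc K N) (a := fun k => ((1 : ℝ) / 2) ^ k)
    (fun k _ => by positivity) (fun k _ => (one_lt_arcEnd hpos hlt k).le)
    (fun k _ => arcEnd_le hpos hlt k) ht hne hj hjt
  exact le_trans (Real.exp_le_exp.2 (by linarith)) (exp_neg_half_pow_le j)

theorem analyticAt_attachedDisk (G : ℝ → ℝ) (x₀ : ℝ) (K N : ℕ) {ζ : ℂ} (hζ : ‖ζ‖ < 1) :
    AnalyticAt ℂ (attachedDisk G x₀ K N) ζ :=
  ((analyticAt_const.add (analyticAt_stripSum fun _ _ => analyticAt_stripMap_of_norm_lt hζ)).mul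
    analyticAt_const).cexp

theorem continuousAt_attachedDisk_exp {G : ℝ → ℝ} (hpos : ∀ x ∈ Ioo (0 : ℝ) 1, 0 < G x)
    (hlt : ∀ x ∈ Ioo (0 : ℝ) 1, G x < 1) (x₀ : ℝ) (K N : ℕ) {t : ℝ} (ht : |t| < Real.pi)
    (hne : ∀ k ∈ Finset.Icc K N, |t| ≠ arcEnd G k) :
    ContinuousAt (attachedDisk G x₀ K N) (Complex.exp (t * I)) := by
  have hpi := Real.pi_gt_three
  refine AnalyticAt.continuousAt (((analyticAt_const.add
    (analyticAt_stripSum fun k hk => ?_)).mul analyticAt_const).cexp)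
  exact analyticAt_stripMap_exp (by linarith [one_lt_arcEnd hpos hlt k])
    (by linarith [arcEnd_le hpos hlt k]) ht (hne k hk)

theorem measurable_attachedArc (G : ℝ → ℝ) (x₀ : ℝ) (K N : ℕ) : Measurable (attachedArc G x₀ K N) :=
  measurable_stripSumArc.const_add x₀

theorem attachedArc_mapsTo {G : ℝ → ℝ} (hpos : ∀ x ∈ Ioo (0 : ℝ) 1, 0 < G x)
    (hlt : ∀ x ∈ Ioo (0 : ℝ) 1, G x < 1) (x₀ : ℝ) {K N : ℕ} {r : ℝ}
    (hr : ∑ k ∈ Finset.Icc K N, (1 / 2) ^ k * Real.log (Real.pi / arcExcess G k) < r) :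
    MapsTo (attachedArc G x₀ K N) (Ioo (-1) 1) (Ioo (x₀ - r) (x₀ + r)) := by
  intro t ht
  have h : |stripSumArc (Finset.Icc K N) (fun k => (1 / 2) ^ k) (arcEnd G) t| < r := by
    refine lt_of_le_of_lt ((Finset.abs_sum_le_sum_abs _ _).trans
      (Finset.sum_le_sum fun k _ => ?_)) hr
    rw [abs_mul, abs_of_pos (by positivity : (0 : ℝ) < (1 / 2) ^ k)]
    refine mul_le_mul_of_nonneg_left (abs_stripArc_le (arcExcess_pos hpos hlt k) ?_
      (abs_lt.2 ht)) (by positivity)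
    linarith [arcExcess_le_half hpos hlt k]
  obtain ⟨h1, h2⟩ := abs_lt.1 h
  exact ⟨by unfold attachedArc; linarith, by unfold attachedArc; linarith⟩

theorem exists_hasDerivAt_attachedArc {G : ℝ → ℝ} (hpos : ∀ x ∈ Ioo (0 : ℝ) 1, 0 < G x)
    (hlt : ∀ x ∈ Ioo (0 : ℝ) 1, G x < 1) (x₀ : ℝ) {K N : ℕ} (hKN : K ≤ N) :
    ∃ θ' : ℝ → ℝ, (∀ t ∈ Ioo (-1 : ℝ) 1, HasDerivAt (attachedArc G x₀ K N) (θ' t) t) ∧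
      (∀ t ∈ Ioo (-1 : ℝ) 1, (1 / 2) ^ K / 10 ≤ θ' t) ∧ ∀ t, |t| ≤ 1 / 2 → θ' t ≤ 6 := by
  refine ⟨fun t => ∑ k ∈ Finset.Icc K N, (1 / 2) ^ k *
    (Real.sin (arcEnd G k) / (Real.cos t - Real.cos (arcEnd G k)) / Real.pi), ?_, ?_, ?_⟩
  · intro t ht
    exact (hasDerivAt_stripSumArc (fun k _ => (one_lt_arcEnd hpos hlt k).le)
      (fun k _ => arcEnd_le hpos hlt k) (abs_lt.2 ht)).const_add x₀
  · intro t ht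
    have key : ∀ k, 1 / 10 ≤
        Real.sin (arcEnd G k) / (Real.cos t - Real.cos (arcEnd G k)) / Real.pi := fun k =>
      le_deriv_stripArc (one_lt_arcEnd hpos hlt k).le (arcEnd_le hpos hlt k)
        ((abs_lt.2 ht).trans (one_lt_arcEnd hpos hlt k))
    refine le_trans ?_ (Finset.single_le_sum (f := fun k => ((1 : ℝ) / 2) ^ k *
      (Real.sin (arcEnd G k) / (Real.cos t - Real.cos (arcEnd G k)) / Real.pi))
      (fun k _ => mul_nonneg (by positivity) (by linarith [key k])) (Finset.left_mem_Icc.2 hKN))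
    rw [div_eq_mul_one_div]
    exact mul_le_mul_of_nonneg_left (key K) (by positivity)
  · intro t ht
    calc _ ≤ ∑ k ∈ Finset.Icc K N, ((1 : ℝ) / 2) ^ k * 3 :=
          Finset.sum_le_sum fun k _ => mul_le_mul_of_nonneg_left
            (deriv_stripArc_le (one_lt_arcEnd hpos hlt k).le (arcEnd_le hpos hlt k) ht)
            (by positivity)
      _ ≤ 6 := by rw [← Finset.sum_mul]; linarith [sum_Icc_half_pow_le K N]

/-! ### Jensen's inequality on the attached disks -/

theorem ae_abs_ne (c : ℝ) : ∀ᵐ t : ℝ, |t| ≠ c := by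
  have h : ({c, -c} : Set ℝ).Finite := by simp
  filter_upwards [compl_mem_ae_iff.2 (h.measure_zero volume)] with t ht hc
  refine ht ?_
  rcases abs_eq_abs.1 (show |t| = |c| by rw [← hc, abs_abs]) with h | h
  · exact Or.inl h
  · exact Or.inr h

/-- The bounds for `log ‖1 - p‖` on the parts of the circle where `|t| > 1`. -/
theorem log_max_le_discMajorant_of_one_lt {G : ℝ → ℝ} (hmono : MonotoneOn G (Icc 0 1))
    (hpos : ∀ x ∈ Ioo (0 : ℝ) 1, 0 < G x) (hlt : ∀ x ∈ Ioo (0 : ℝ) 1, G x < 1) {p : ℂ[X]}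
    {x₀ δ M : ℝ} {K N : ℕ} (hKN : K ≤ N) (f : ℝ → ℝ) (hδ : 0 < δ) (hδ1 : δ ≤ 1) (hM1 : 1 ≤ M)
    (hM : ∀ z : ℂ, ‖z‖ ≤ Real.exp 6 → ‖(1 - p).eval z‖ ≤ M)
    (hp : ∫⁻ ζ, ‖p.eval ζ‖ₑ ^ 2 ∂(diskPart G) ≤ 1) {t : ℝ} (ht1 : 1 < |t|) (htpi : |t| < Real.pi)
    (hne : ∀ k ∈ Finset.Icc K N, |t| ≠ arcEnd G k) :
    Real.log (max ‖(1 - p).eval (attachedDisk G x₀ K N (Complex.exp (t * I)))‖ δ) ≤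
      discMajorant G f (Real.log M) K N t := by
  have hD : ∀ k : ℕ, 0 ≤ k + 3 + logInv G (k + 2) := fun k => by
    have := logInv_pos hpos hlt (show 1 ≤ k + 2 by omega)
    positivity
  have h1 : (Ioo (-1 : ℝ) 1).indicator f t = 0 :=
    indicator_of_notMem (fun h : t ∈ Ioo (-1 : ℝ) 1 => absurd (abs_lt.2 h) (not_lt.2 ht1.le)) _
  have h2 : 0 ≤ (arcPair (arcEnd G N)).indicator (fun _ => Real.log M) t :=
    indicator_nonneg (fun _ _ => Real.log_nonneg hM1) _
  have h3 : ∀ k ∈ Finset.Ioc K N, 0 ≤ (arcPair (arcEnd G (k - 1))).indicator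
      (fun _ => (k : ℝ) + 3 + logInv G (k + 2)) t := fun k _ => indicator_nonneg (fun _ _ => hD k) _
  have h4 := Finset.sum_nonneg h3
  unfold discMajorant
  rw [h1]
  by_cases hall : ∀ k ∈ Finset.Icc K N, |t| < arcEnd G k
  · have hb : ‖(1 - p).eval (attachedDisk G x₀ K N (Complex.exp (t * I)))‖ ≤ M :=
      hM _ ((norm_attachedDisk_exp_of_abs_lt hpos hlt x₀ K N hall).trans_le
        (Real.one_le_exp (by norm_num)))
    have hu := Real.log_le_log (lt_max_of_lt_right hδ) (max_le hb (hδ1.trans hM1))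
    rw [indicator_of_mem (show t ∈ arcPair (arcEnd G N) from
      ⟨ht1, hall N (Finset.right_mem_Icc.2 hKN)⟩)]
    linarith [hD K]
  · -- Let `j` be the least index such that the point lies beyond the arc number `j`.
    push Not at hall
    have hex : ∃ k, k ∈ Finset.Icc K N ∧ arcEnd G k < |t| := by
      obtain ⟨k, hk, hkt⟩ := hall
      exact ⟨k, hk, lt_of_le_of_ne hkt (hne k hk).symm⟩
    classical
    obtain ⟨hj, hjt⟩ := Nat.find_spec hex
    have hmin : ∀ i < Nat.find hex, i ∈ Finset.Icc K N → ¬ arcEnd G i < |t| := fun i hi h h' =>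
      Nat.find_min hex hi ⟨h, h'⟩
    set j := Nat.find hex
    have hu := log_max_norm_one_sub_eval_le hmono hpos hlt hδ hδ1
      (norm_attachedDisk_exp_le hpos hlt x₀ htpi hne hj hjt) hp
    have hjm := Finset.mem_Icc.1 hj
    rcases eq_or_lt_of_le hjm.1 with hK | hK
    · rw [← hK] at hu
      linarith
    · have hj1 : j - 1 ∈ Finset.Icc K N := Finset.mem_Icc.2 ⟨by omega, by omega⟩
      have hlt' : |t| < arcEnd G (j - 1) :=
        lt_of_le_of_ne (not_lt.1 (hmin (j - 1) (by omega) hj1)) (hne _ hj1)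
      have h5 := Finset.single_le_sum h3 (Finset.mem_Ioc.2 ⟨hK, hjm.2⟩)
      rw [indicator_of_mem (show t ∈ arcPair (arcEnd G (j - 1)) from ⟨ht1, hlt'⟩)] at h5
      linarith [hD K]

/-- Jensen's inequality along the attached disk: if `p` is close to the characteristic function
of `A` near `exp (i x₀)`, with an error at most `σ`, then the right side contains a negative term
proportional to `log (1 / σ)` and to the measure of `A` near `exp (i x₀)`. The other terms depend
neither on `p` nor on `N`. -/
theorem two_pi_mul_log_half_le {G : ℝ → ℝ} (hmono : MonotoneOn G (Icc 0 1))
    (hpos : ∀ x ∈ Ioo (0 : ℝ) 1, 0 < G x) (hlt : ∀ x ∈ Ioo (0 : ℝ) 1, G x < 1) {W : ℝ → ℝ}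
    {A : Set ℂ} (hA : MeasurableSet A) {p : ℂ[X]} {x₀ r σ M : ℝ} {K N : ℕ} (hKN : K ≤ N)
    (hr : ∑ k ∈ Finset.Icc K N, (1 / 2) ^ k * Real.log (Real.pi / arcExcess G k) < r)
    (hWpos : ∀ᵐ s ∂volume.restrict (Ioo (x₀ - r) (x₀ + r)), 0 < W s)
    (hW : IntegrableOn W (Ioo (x₀ - r) (x₀ + r)))
    (hlog : IntegrableOn (fun s => Real.log (W s)) (Ioo (x₀ - r) (x₀ + r)))
    (hσ : 0 < σ) (hσ1 : σ ≤ 1) (hM1 : 1 ≤ M)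
    (hM : ∀ z : ℂ, ‖z‖ ≤ Real.exp 6 → ‖(1 - p).eval z‖ ≤ M)
    (hN : 2 * arcExcess G N * Real.log M ≤ 1)
    (hp : ∫⁻ ζ, ‖p.eval ζ‖ₑ ^ 2 ∂(diskPart G) ≤ 1)
    (hpA : IntegrableOn (fun s => W s * ‖p.eval (Complex.exp (s * I)) -
      A.indicator (fun _ => 1) (Complex.exp (s * I))‖ ^ 2) (Ioo (x₀ - r) (x₀ + r)))
    (hpAσ : ∫ s in Ioo (x₀ - r) (x₀ + r), W s * ‖p.eval (Complex.exp (s * I)) -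
      A.indicator (fun _ => 1) (Complex.exp (s * I))‖ ^ 2 ≤ σ)
    (h0 : 1 / 2 ≤ ‖(1 - p).eval (attachedDisk G x₀ K N 0)‖) :
    2 * Real.pi * Real.log (1 / 2) ≤
      ((1 / 2) ^ K / 10)⁻¹ * (2 * (∫ s in Ioo (x₀ - r) (x₀ + r), W s) + 1 +
        1 / 2 * ∫ s in Ioo (x₀ - r) (x₀ + r), |Real.log (W s)|) +
      1 / 2 * Real.log σ * (volume.real ((fun s : ℝ => Complex.exp (s * I)) ⁻¹' A ∩
        Ioo (x₀ - (1 / 2) ^ K / 10 / 2) (x₀ + (1 / 2) ^ K / 10 / 2)) / 6) + 1 +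
      2 * Real.pi * (K + 3 + logInv G (K + 2)) + 2 * ∑' k : ℕ, ((1 : ℝ) / 2) ^ k * (k + 4) := by
  have hpi := Real.pi_gt_three
  set J := Ioo (x₀ - r) (x₀ + r) with hJ
  set e : ℝ → ℂ := fun s => Complex.exp (s * I) with he
  have hem : Measurable e := by rw [he]; fun_prop
  have heA : MeasurableSet (e ⁻¹' A) := hem hA
  set v : ℝ → ℝ := fun s => ‖p.eval (e s) - A.indicator (fun _ => 1) (e s)‖ with hv
  set φ := attachedDisk G x₀ K N with hφ
  set θ := attachedArc G x₀ K N with hθ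
  set c : ℝ := (1 / 2) ^ K / 10 with hc
  have hc0 : 0 < c := by positivity
  have hδ : 0 < √σ := Real.sqrt_pos.2 hσ
  have hδ1 : √σ ≤ 1 := Real.sqrt_le_one.2 hσ1
  obtain ⟨θ', hd, hdl, hdu⟩ := exists_hasDerivAt_attachedArc hpos hlt x₀ hKN
  have hθm : Measurable θ := measurable_attachedArc G x₀ K N
  have hmap := map_restrict_le_of_le_deriv hθm hd hc0 hdl (attachedArc_mapsTo hpos hlt x₀ hr)
  -- The majorant on the arc `|t| < 1`.
  set X : ℝ → ℝ := fun s => 2 * W s + W s * v s ^ 2 / σ + 1 / 2 * |Real.log (W s)| with hX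
  have hXi : IntegrableOn X J := ((hW.const_mul 2).add (hpA.div_const σ)).add (hlog.abs.const_mul _)
  have hX0 : ∀ᵐ s ∂volume.restrict J, 0 ≤ X s := hWpos.mono fun s hs => by positivity
  obtain ⟨hXθ, hXθle⟩ := integral_comp_le_of_map_le (inv_nonneg.2 hc0.le) hθm hmap hXi hX0
  have hXJ : ∫ s in J, X s ≤ 2 * (∫ s in J, W s) + 1 + 1 / 2 * ∫ s in J, |Real.log (W s)| := by
    have i1 : IntegrableOn (fun s => 2 * W s) J := hW.const_mul 2
    have i2 : IntegrableOn (fun s => W s * v s ^ 2 / σ) J := hpA.div_const σ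
    have i3 : IntegrableOn (fun s => 1 / 2 * |Real.log (W s)|) J := hlog.abs.const_mul _
    have i12 : IntegrableOn (fun s => 2 * W s + W s * v s ^ 2 / σ) J := i1.add i2
    rw [hX, integral_add i12 i3, integral_add i1 i2, integral_const_mul, integral_const_mul,
      integral_div]
    gcongr
    rw [div_le_one hσ]
    exact hpAσ
  set f : ℝ → ℝ := fun t => X (θ t) + 1 / 2 * Real.log σ *
    (θ ⁻¹' (e ⁻¹' A)).indicator (fun _ => 1) t with hf
  have hTm : MeasurableSet (θ ⁻¹' (e ⁻¹' A)) := hθm heA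
  have hind : IntegrableOn ((θ ⁻¹' (e ⁻¹' A)).indicator fun _ => (1 : ℝ)) (Ioo (-1) 1) :=
    (integrable_const (1 : ℝ)).indicator hTm
  have hfi : IntegrableOn f (Ioo (-1) 1) := hXθ.add (hind.const_mul _)
  have hlogσ : Real.log σ ≤ 0 := Real.log_nonpos hσ.le hσ1
  have hfle : ∫ t in Ioo (-1) 1, f t ≤ c⁻¹ * (2 * (∫ s in J, W s) + 1 +
      1 / 2 * ∫ s in J, |Real.log (W s)|) + 1 / 2 * Real.log σ *
      (volume.real (e ⁻¹' A ∩ Ioo (x₀ - c / 2) (x₀ + c / 2)) / 6) := by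
    rw [hf, integral_add hXθ (hind.const_mul _), integral_const_mul]
    refine add_le_add (hXθle.trans (mul_le_mul_of_nonneg_left hXJ (inv_nonneg.2 hc0.le))) ?_
    refine mul_le_mul_of_nonpos_left ?_ (by linarith)
    rw [integral_indicator hTm, setIntegral_const, smul_eq_mul, mul_one,
      measureReal_restrict_apply hTm,       div_le_iff₀ (by norm_num)]
    have h := volume_inter_Ioo_le_mul_preimage (x₀ := x₀) hθm hd hc0 hdl hdu
      (show attachedArc G x₀ K N 0 = x₀ by rw [attachedArc, stripSumArc_zero, add_zero]) heA
    have hfin : volume (θ ⁻¹' (e ⁻¹' A) ∩ Ioo (-1) 1) ≠ ∞ :=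
      ne_top_of_le_ne_top measure_Ioo_lt_top.ne (measure_mono inter_subset_right)
    have h' := ENNReal.toReal_mono (ENNReal.mul_ne_top ENNReal.ofReal_ne_top hfin) h
    rw [ENNReal.toReal_mul, ENNReal.toReal_ofReal (by norm_num)] at h'
    rw [measureReal_def, measureReal_def]
    linarith
  -- Jensen's inequality.
  have hne : ∀ᵐ t : ℝ, |t| ≠ 1 ∧ ∀ k ∈ Finset.Icc K N, |t| ≠ arcEnd G k :=
    (ae_abs_ne 1).and ((Finset.eventually_all _).2 fun k _ => ae_abs_ne _)
  have hg0 : (1 - p).eval (φ 0) ≠ 0 := norm_pos_iff.1 (by linarith)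
  obtain ⟨hui, hjensen⟩ := log_norm_le_integral_log_max (g := fun ζ => (1 - p).eval (φ ζ)) hδ
    (fun ζ hζ => ((1 - p).differentiable.analyticAt _).comp (analyticAt_attachedDisk G x₀ K N hζ))
    (fun ζ => hM _ (norm_attachedDisk_le hpos hlt x₀ K N ζ)) hg0 (by
      filter_upwards [ae_restrict_of_ae hne, ae_restrict_mem measurableSet_Ioo] with t ht ht'
      exact ContinuousAt.comp (g := fun z => (1 - p).eval z) (1 - p).continuous.continuousAt
        (continuousAt_attachedDisk_exp hpos hlt x₀ K N (abs_lt.2 ht') ht.2))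
  have hWθ : ∀ᵐ t : ℝ, t ∈ Ioo (-1 : ℝ) 1 → 0 < W (θ t) := by
    rw [← ae_restrict_iff' measurableSet_Ioo]
    refine ae_of_ae_map hθm.aemeasurable (p := fun s => 0 < W s) ?_
    exact (Measure.absolutelyContinuous_of_le_smul hmap).ae_le hWpos
  obtain ⟨hVi, hVle⟩ := integral_discMajorant_le hpos hlt hfi (Real.log_nonneg hM1) K N
  have hD : ∀ k : ℕ, 0 ≤ k + 3 + logInv G (k + 2) := fun k => by
    have := logInv_pos hpos hlt (show 1 ≤ k + 2 by omega)
    positivity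
  have huV : ∫ t in Ioo (-Real.pi) Real.pi,
      Real.log (max ‖(1 - p).eval (φ (Complex.exp (t * I)))‖ √σ) ≤
      ∫ t in Ioo (-Real.pi) Real.pi, discMajorant G f (Real.log M) K N t := by
    refine integral_mono_ae hui hVi ?_
    filter_upwards [ae_restrict_of_ae hne, ae_restrict_of_ae hWθ,
      ae_restrict_mem measurableSet_Ioo] with t ht htW htpi
    rcases lt_or_gt_of_ne ht.1 with h1 | h1
    · have hmem : t ∈ Ioo (-1 : ℝ) 1 := abs_lt.1 h1
      have hWt := htW hmem
      have hft : Real.log (max ‖(1 - p).eval (φ (Complex.exp (t * I)))‖ √σ) ≤ f t := by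
        rw [hφ, attachedDisk_exp_of_abs_lt hpos hlt x₀ K N h1]
        change Real.log (max ‖(1 - p).eval (e (θ t))‖ √σ) ≤ _
        by_cases hmA : e (θ t) ∈ A
        · have : (θ ⁻¹' (e ⁻¹' A)).indicator (fun _ => (1 : ℝ)) t = 1 :=
            indicator_of_mem (show t ∈ θ ⁻¹' (e ⁻¹' A) from hmA) _
          rw [hf]
          simp only [this, mul_one]
          refine log_max_sqrt_le_of_le hWt hσ (norm_nonneg _) ?_
          simp only [hv, indicator_of_mem hmA, eval_sub, eval_one]
          rw [norm_sub_rev]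
        · have : (θ ⁻¹' (e ⁻¹' A)).indicator (fun _ => (1 : ℝ)) t = 0 :=
            indicator_of_notMem (show t ∉ θ ⁻¹' (e ⁻¹' A) from hmA) _
          rw [hf]
          simp only [this, mul_zero, add_zero]
          refine log_max_sqrt_le_of_le_one_add hWt hσ hσ1 (norm_nonneg _) ?_
          simp only [hv, indicator_of_notMem hmA, eval_sub, eval_one, sub_zero]
          exact (norm_sub_le _ _).trans (by simp)
      have hz : ∀ b D : ℝ, (arcPair b).indicator (fun _ => D) t = 0 := fun b D =>
        indicator_of_notMem (fun h => absurd h.1 (not_lt.2 h1.le)) _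
      refine hft.trans ?_
      unfold discMajorant
      rw [indicator_of_mem hmem, hz, Finset.sum_eq_zero fun k _ => hz _ _]
      linarith [hD K]
    · exact log_max_le_discMajorant_of_one_lt hmono hpos hlt hKN f hδ hδ1 hM1 hM hp h1
        (abs_lt.2 htpi) ht.2
  have hlow : 2 * Real.pi * Real.log (1 / 2) ≤ 2 * Real.pi * Real.log ‖(1 - p).eval (φ 0)‖ :=
    mul_le_mul_of_nonneg_left (Real.log_le_log (by norm_num) h0) (by positivity)
  linarith

/-- If polynomials tend to `0` in the disk and to the characteristic function of `A` on an arc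
around `exp (i x₀)` on which `log W` is integrable, then `A` is null near `exp (i x₀)`. -/
theorem exists_volume_preimage_inter_eq_zero {G : ℝ → ℝ} (hmono : MonotoneOn G (Icc 0 1))
    (hpos : ∀ x ∈ Ioo (0 : ℝ) 1, 0 < G x) (hlt : ∀ x ∈ Ioo (0 : ℝ) 1, G x < 1)
    (hint : LogLogInt G) {W : ℝ → ℝ} {A : Set ℂ} (hA : MeasurableSet A) {x₀ r : ℝ} (hr : 0 < r)
    (hWpos : ∀ᵐ s ∂volume.restrict (Ioo (x₀ - r) (x₀ + r)), 0 < W s)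
    (hW : IntegrableOn W (Ioo (x₀ - r) (x₀ + r)))
    (hlog : IntegrableOn (fun s => Real.log (W s)) (Ioo (x₀ - r) (x₀ + r)))
    (happ : ∀ ε > 0, ∃ p : ℂ[X], ∫⁻ ζ, ‖p.eval ζ‖ₑ ^ 2 ∂(diskPart G) ≤ ENNReal.ofReal ε ∧
      IntegrableOn (fun s => W s * ‖p.eval (Complex.exp (s * I)) -
        A.indicator (fun _ => 1) (Complex.exp (s * I))‖ ^ 2) (Ioo (x₀ - r) (x₀ + r)) ∧
      ∫ s in Ioo (x₀ - r) (x₀ + r), W s * ‖p.eval (Complex.exp (s * I)) -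
        A.indicator (fun _ => 1) (Complex.exp (s * I))‖ ^ 2 ≤ ε) :
    ∃ c > 0, volume ((fun s : ℝ => Complex.exp (s * I)) ⁻¹' A ∩ Ioo (x₀ - c) (x₀ + c)) = 0 := by
  -- The tails of the series of the `arcExcess` confine the attached arcs to the given arc.
  obtain ⟨s, hs⟩ := (summable_log_arcExcess hpos hlt hmono hint).vanishing (Iio_mem_nhds hr)
  set K := s.sup id + 1 with hK
  have hsum : ∀ N, ∑ k ∈ Finset.Icc K N, (1 / 2) ^ k * Real.log (Real.pi / arcExcess G k) < r := by
    intro N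
    refine hs _ (Finset.disjoint_left.2 fun k hk hks => ?_)
    have h1 : k ≤ s.sup id := Finset.le_sup (f := id) hks
    have h2 := (Finset.mem_Icc.1 hk).1
    omega
  refine ⟨(1 / 2) ^ K / 10 / 2, by positivity, ?_⟩
  by_contra hne
  set m := volume.real ((fun s : ℝ => Complex.exp (s * I)) ⁻¹' A ∩
    Ioo (x₀ - (1 / 2) ^ K / 10 / 2) (x₀ + (1 / 2) ^ K / 10 / 2)) with hm
  have hm0 : 0 < m := ENNReal.toReal_pos hne
    (ne_top_of_le_ne_top measure_Ioo_lt_top.ne (measure_mono inter_subset_right))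
  set B := ((1 / 2) ^ K / 10)⁻¹ * (2 * (∫ s in Ioo (x₀ - r) (x₀ + r), W s) + 1 +
        1 / 2 * ∫ s in Ioo (x₀ - r) (x₀ + r), |Real.log (W s)|) + 1 +
      2 * Real.pi * (K + 3 + logInv G (K + 2)) + 2 * ∑' k : ℕ, ((1 : ℝ) / 2) ^ k * (k + 4) -
      2 * Real.pi * Real.log (1 / 2) with hB
  -- The negative term in Jensen's inequality is then `-(|B| + 1)`, too small to be compensated.
  set Λ := 12 * (|B| + 1) / m with hΛ
  have hΛ0 : 0 < Λ := by positivity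
  set σ := Real.exp (-Λ) with hσ
  have hσ0 : 0 < σ := Real.exp_pos _
  have hσ1 : σ ≤ 1 := Real.exp_le_one_iff.2 (by linarith)
  set x : ℝ := (1 / 2) ^ (K + 2) with hx
  have hx01 : x ∈ Ioo (0 : ℝ) 1 := half_pow_mem_Ioo (by omega)
  have hGx : 0 < G (x / 2) := hpos _ ⟨by linarith [hx01.1], by linarith [hx01.2]⟩
  -- This bound for the squared norm of `p` implies `‖p‖ ≤ 1 / 2` at the centre of the disk.
  set η := x ^ 2 / 4 * G (x / 2) * (1 / 4) with hη
  have hη0 : 0 < η := by have := hx01.1; positivity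
  obtain ⟨p, hp, hpi, hpσ⟩ := happ (min σ (min 1 η)) (by positivity)
  obtain ⟨M₀, hM₀⟩ := (isCompact_closedBall (0 : ℂ) (Real.exp 6)).exists_bound_of_continuousOn
    (1 - p).continuous.continuousOn
  set M := max M₀ 1 with hM
  have hM1 : 1 ≤ M := le_max_right _ _
  obtain ⟨n, hn⟩ := exists_pow_lt_of_lt_one (show 0 < 1 / (Real.log M + 1) by
    have := Real.log_nonneg hM1; positivity) (show (1 / 2 : ℝ) < 1 by norm_num)
  -- The choice of `N` makes the uncontrolled arcs short in terms of the maximum `M` of `‖1 - p‖`.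
  set N := max K n with hN
  have hNM : 2 * arcExcess G N * Real.log M ≤ 1 := by
    have hlogM := Real.log_nonneg hM1
    rw [lt_div_iff₀ (by positivity)] at hn
    have h1 := arcExcess_le_pow hpos hlt N
    have h2 : ((1 : ℝ) / 2) ^ N ≤ (1 / 2) ^ n :=
      pow_le_pow_of_le_one (by norm_num) (by norm_num) (le_max_right _ _)
    have h3 : (0 : ℝ) < (1 / 2) ^ n := by positivity
    rw [pow_succ] at h1
    have h4 : 2 * arcExcess G N ≤ (1 / 2) ^ n := by linarith
    nlinarith [mul_le_mul_of_nonneg_right h4 hlogM]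
  have h0 : 1 / 2 ≤ ‖(1 - p).eval (attachedDisk G x₀ K N 0)‖ := by
    have h1 := norm_eval_sq_le hmono hx01.1 hx01.2.le
      (norm_attachedDisk_zero_le hpos hlt x₀ (le_max_left K n)) hη0.le
      (hp.trans (ENNReal.ofReal_le_ofReal ((min_le_right _ _).trans (min_le_right _ _))))
    have h2 : ‖p.eval (attachedDisk G x₀ K N 0)‖ ^ 2 ≤ (1 / 2) ^ 2 := by
      have := le_of_mul_le_mul_left h1 (by have := hx01.1; positivity)
      linarith
    have h3 := (pow_le_pow_iff_left₀ (norm_nonneg _) (by norm_num) two_ne_zero).1 h2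
    rw [eval_sub, eval_one]
    have h4 := norm_sub_norm_le (1 : ℂ) (p.eval (attachedDisk G x₀ K N 0))
    rw [norm_one] at h4
    linarith
  have hp1 : ∫⁻ ζ, ‖p.eval ζ‖ₑ ^ 2 ∂(diskPart G) ≤ 1 := by
    refine hp.trans ?_
    rw [← ENNReal.ofReal_one]
    exact ENNReal.ofReal_le_ofReal ((min_le_right _ _).trans (min_le_left _ _))
  have key := two_pi_mul_log_half_le hmono hpos hlt hA (le_max_left K n) (hsum N) hWpos hW hlog
    hσ0 hσ1 hM1 (fun z hz => (hM₀ z (mem_closedBall_zero_iff.2 hz)).trans (le_max_left _ _)) hNM hp1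
    hpi (hpσ.trans (min_le_left _ _)) h0
  rw [← hm, hσ, Real.log_exp] at key
  have h5 : 1 / 2 * -Λ * (m / 6) = -(|B| + 1) := by
    rw [hΛ]; field_simp; ring
  rw [h5] at key
  linarith [le_abs_self B]

/-! ### Characteristic functions in the disk -/

theorem measurable_enorm_eval_sub_indicator (p : ℂ[X]) {A : Set ℂ} (hA : MeasurableSet A) :
    Measurable fun z => ‖p.eval z - A.indicator (fun _ => 1) z‖ₑ ^ 2 :=
  ((p.continuous.measurable.sub (measurable_const.indicator hA)).enorm).pow_const 2

theorem exists_lintegral_enorm_eval_sub_le {μ : Measure ℂ} {A : Set ℂ} {f : Lp ℂ 2 μ}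
    (hf : f ∈ P2 μ) (hfA : f =ᵐ[μ] A.indicator fun _ => (1 : ℂ)) {ε : ℝ} (hε : 0 < ε) :
    ∃ p : ℂ[X], ∫⁻ z, ‖p.eval z - A.indicator (fun _ => 1) z‖ₑ ^ 2 ∂μ ≤ ENNReal.ofReal ε := by
  obtain ⟨g, ⟨p, hp⟩, hg⟩ := EMetric.mem_closure_iff.1 hf (ENNReal.ofReal √ε)
    (ENNReal.ofReal_pos.2 (Real.sqrt_pos.2 hε))
  refine ⟨p, ?_⟩
  rw [edist_comm, Lp.edist_def] at hg
  have h1 : eLpNorm (⇑g - ⇑f) 2 μ =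
      eLpNorm (fun z => p.eval z - A.indicator (fun _ => 1) z) 2 μ :=
    eLpNorm_congr_ae (hp.sub hfA)
  rw [h1] at hg
  have h2 := eLpNorm_nnreal_pow_eq_lintegral (μ := μ) (p := 2)
    (f := fun z => p.eval z - A.indicator (fun _ => (1 : ℂ)) z) two_ne_zero
  simp only [NNReal.coe_ofNat, ENNReal.coe_ofNat, ENNReal.rpow_ofNat] at h2
  rw [← h2]
  refine (pow_le_pow_left' hg.le 2).trans_eq ?_
  rw [← ENNReal.ofReal_pow (Real.sqrt_nonneg _), Real.sq_sqrt hε.le]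

theorem enorm_sub_sq_le (a b c : ℂ) : ‖a - b‖ₑ ^ 2 ≤ 2 * (‖a - c‖ₑ ^ 2 + ‖b - c‖ₑ ^ 2) := by
  have h : ‖a - b‖ ^ 2 ≤ 2 * (‖a - c‖ ^ 2 + ‖b - c‖ ^ 2) := by
    have h1 : ‖a - b‖ ≤ ‖a - c‖ + ‖b - c‖ := by
      rw [← norm_neg (b - c), neg_sub]
      simpa using norm_add_le (a - c) (c - b)
    nlinarith [norm_nonneg (a - b), sq_nonneg (‖a - c‖ - ‖b - c‖)]
  have := ENNReal.ofReal_le_ofReal h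
  rwa [ENNReal.ofReal_mul two_pos.le, ENNReal.ofReal_add (by positivity) (by positivity),
    ENNReal.ofReal_pow (norm_nonneg _), ENNReal.ofReal_pow (norm_nonneg _),
    ENNReal.ofReal_pow (norm_nonneg _), ofReal_norm, ofReal_norm, ofReal_norm,
    ENNReal.ofReal_ofNat] at this

theorem diskPart_compl_ball (G : ℝ → ℝ) : diskPart G (Metric.ball 0 1)ᶜ = 0 := by
  rw [diskPart, Measure.smul_apply, withDensity_apply _ measurableSet_ball.compl,
    Measure.restrict_restrict measurableSet_ball.compl, compl_inter_self, Measure.restrict_empty,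
    lintegral_zero_measure, smul_zero]

theorem diskPart_pos_of_isOpen {G : ℝ → ℝ} (hmono : MonotoneOn G (Icc 0 1))
    (hpos : ∀ x ∈ Ioo (0 : ℝ) 1, 0 < G x) {V : Set ℂ} (hV : IsOpen V)
    (hne : (V ∩ Metric.ball 0 1).Nonempty) : 0 < diskPart G V := by
  obtain ⟨z, hzV, hz⟩ := hne
  have hz1 : ‖z‖ < 1 := mem_ball_zero_iff.1 hz
  set x := (1 - ‖z‖) / 2 with hx
  have hx0 : 0 < x := by linarith
  have hx1 : x < 1 := by linarith [norm_nonneg z]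
  have hG := hpos x ⟨hx0, hx1⟩
  have hpi := Real.pi_pos
  refine lt_of_lt_of_le ?_ (smul_restrict_ball_le_diskPart hmono hx0.le hx1.le V)
  rw [Measure.smul_apply, smul_eq_mul, Measure.restrict_apply hV.measurableSet]
  refine ENNReal.mul_pos (ENNReal.ofReal_pos.2 (by positivity)).ne' ?_
  refine ((hV.inter Metric.isOpen_ball).measure_pos volume ⟨z, hzV, ?_⟩).ne'
  rw [mem_ball_zero_iff]; linarith

/-- Limits in `L²(diskPart G)` of polynomials are continuous in the disk. Hence a limit which is a
characteristic function is constant. -/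
theorem diskPart_eq_zero_or_compl {G : ℝ → ℝ} (hmono : MonotoneOn G (Icc 0 1))
    (hpos : ∀ x ∈ Ioo (0 : ℝ) 1, 0 < G x) {A : Set ℂ} (hA : MeasurableSet A)
    (happ : ∀ ε > 0, ∃ p : ℂ[X],
      ∫⁻ z, ‖p.eval z - A.indicator (fun _ => 1) z‖ₑ ^ 2 ∂(diskPart G) ≤ ENNReal.ofReal ε) :
    diskPart G A = 0 ∨ diskPart G Aᶜ = 0 := by
  have hε : ∀ n : ℕ, (0 : ℝ) < 1 / (n + 1) := fun n => by positivity
  choose p hp using fun n : ℕ => happ _ (hε n)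
  have hcauchy : ∀ x ∈ Ioo (0 : ℝ) 1, UniformCauchySeqOn (fun n z => (p n).eval z) atTop
      (Metric.ball 0 (1 - x)) := by
    intro x hx
    have hG := hpos (x / 2) ⟨by linarith [hx.1], by linarith [hx.2]⟩
    have hx0 := hx.1
    rw [Metric.uniformCauchySeqOn_iff]
    intro δ hδ
    obtain ⟨n₀, hn₀⟩ := exists_nat_one_div_lt
      (show 0 < x ^ 2 / 4 * G (x / 2) * δ ^ 2 / 4 by positivity)
    refine ⟨n₀, fun m hm n hn z hz => ?_⟩
    have hle : ∀ k ≥ n₀, (1 : ℝ) / (k + 1) ≤ 1 / (n₀ + 1) := fun k hk => by gcongr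
    have hint : ∫⁻ ζ, ‖(p m - p n).eval ζ‖ₑ ^ 2 ∂(diskPart G) ≤
        ENNReal.ofReal (4 * (1 / (n₀ + 1))) := by
      calc ∫⁻ ζ, ‖(p m - p n).eval ζ‖ₑ ^ 2 ∂(diskPart G)
          ≤ ∫⁻ ζ, 2 * (‖(p m).eval ζ - A.indicator (fun _ => 1) ζ‖ₑ ^ 2 +
            ‖(p n).eval ζ - A.indicator (fun _ => 1) ζ‖ₑ ^ 2) ∂(diskPart G) := by
            refine lintegral_mono fun ζ => ?_
            rw [eval_sub]
            exact enorm_sub_sq_le _ _ _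
        _ = 2 * (∫⁻ ζ, ‖(p m).eval ζ - A.indicator (fun _ => 1) ζ‖ₑ ^ 2 ∂(diskPart G) +
            ∫⁻ ζ, ‖(p n).eval ζ - A.indicator (fun _ => 1) ζ‖ₑ ^ 2 ∂(diskPart G)) := by
            rw [lintegral_const_mul' _ _ ENNReal.ofNat_ne_top,
              lintegral_add_left (measurable_enorm_eval_sub_indicator _ hA)]
        _ ≤ 2 * (ENNReal.ofReal (1 / (n₀ + 1)) + ENNReal.ofReal (1 / (n₀ + 1))) := by
            gcongr
            · exact (hp m).trans (ENNReal.ofReal_le_ofReal (hle m hm))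
            · exact (hp n).trans (ENNReal.ofReal_le_ofReal (hle n hn))
        _ = _ := by
            rw [← ENNReal.ofReal_add (by positivity) (by positivity), ← ENNReal.ofReal_ofNat 2,
              ← ENNReal.ofReal_mul two_pos.le]
            congr 1; ring
    have h1 := norm_eval_sq_le hmono hx.1 hx.2.le (mem_ball_zero_iff.1 hz).le (by positivity) hint
    rw [dist_eq_norm, ← eval_sub]
    have hc : 0 < x ^ 2 / 4 * G (x / 2) := by positivity
    have h2 : x ^ 2 / 4 * G (x / 2) * ‖(p m - p n).eval z‖ ^ 2 < x ^ 2 / 4 * G (x / 2) * δ ^ 2 := by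
      linarith
    exact lt_of_pow_lt_pow_left₀ 2 hδ.le (lt_of_mul_lt_mul_left h2 hc.le)
  have hball : ∀ z ∈ Metric.ball (0 : ℂ) 1, ∃ x ∈ Ioo (0 : ℝ) 1,
      z ∈ Metric.ball (0 : ℂ) (1 - x) := by
    intro z hz
    rw [mem_ball_zero_iff] at hz
    refine ⟨(1 - ‖z‖) / 2, ⟨by linarith, by linarith [norm_nonneg z]⟩, ?_⟩
    rw [mem_ball_zero_iff]; linarith
  have hlim : ∀ z, ∃ y, z ∈ Metric.ball (0 : ℂ) 1 →
      Tendsto (fun n => (p n).eval z) atTop (𝓝 y) := by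
    intro z
    by_cases hz : z ∈ Metric.ball (0 : ℂ) 1
    · obtain ⟨x, hx, hzx⟩ := hball z hz
      obtain ⟨y, hy⟩ := cauchySeq_tendsto_of_complete ((hcauchy x hx).cauchySeq hzx)
      exact ⟨y, fun _ => hy⟩
    · exact ⟨0, fun h => absurd h hz⟩
  choose F hF using hlim
  have hFc : ContinuousOn F (Metric.ball 0 1) := by
    intro z hz
    obtain ⟨x, hx, hzx⟩ := hball z hz
    have hsub : Metric.ball (0 : ℂ) (1 - x) ⊆ Metric.ball 0 1 :=
      Metric.ball_subset_ball (by linarith [hx.1])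
    have h := (hcauchy x hx).tendstoUniformlyOn_of_tendsto fun y hy => hF y (hsub hy)
    have hc : ContinuousOn F (Metric.ball 0 (1 - x)) :=
      h.continuousOn (Frequently.of_forall fun n => (p n).continuous.continuousOn)
    exact (hc.continuousAt (Metric.isOpen_ball.mem_nhds hzx)).continuousWithinAt
  -- By Fatou's lemma, the pointwise limit agrees with the limit in the mean.
  have hFA : ∀ᵐ z ∂(diskPart G), F z = A.indicator (fun _ => 1) z := by
    have h0 : ∫⁻ z, liminf (fun n => ‖(p n).eval z - A.indicator (fun _ => 1) z‖ₑ ^ 2) atTop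
        ∂(diskPart G) = 0 := by
      refine le_antisymm ((lintegral_liminf_le fun n =>
        measurable_enorm_eval_sub_indicator (p n) hA).trans ?_) zero_le
      have ht : Tendsto (fun n => ∫⁻ z, ‖(p n).eval z - A.indicator (fun _ => 1) z‖ₑ ^ 2
          ∂(diskPart G)) atTop (𝓝 0) := by
        refine tendsto_of_tendsto_of_tendsto_of_le_of_le tendsto_const_nhds ?_
          (fun n => zero_le) hp
        have := ENNReal.tendsto_ofReal (tendsto_one_div_add_atTop_nhds_zero_nat (𝕜 := ℝ))
        rwa [ENNReal.ofReal_zero] at this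
      exact ht.liminf_eq.le
    rw [lintegral_eq_zero_iff (.liminf fun n => measurable_enorm_eval_sub_indicator (p n) hA)] at h0
    filter_upwards [h0, compl_mem_ae_iff.2 (diskPart_compl_ball G)] with z hz hzb
    have hzb' : z ∈ Metric.ball (0 : ℂ) 1 := by simpa using hzb
    have h1 : Tendsto (fun n => ‖(p n).eval z - A.indicator (fun _ => 1) z‖ₑ ^ 2) atTop
        (𝓝 (‖F z - A.indicator (fun _ => 1) z‖ₑ ^ 2)) :=
      (ENNReal.continuous_pow 2).continuousAt.tendsto.comp
        ((continuous_enorm.tendsto _).comp ((hF z hzb').sub_const _))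
    rw [h1.liminf_eq] at hz
    simpa [sub_eq_zero] using hz
  -- The set where `F` differs from `0` and `1` is open and null, hence empty.
  have hF01 : MapsTo F (Metric.ball 0 1) {0, 1} := by
    intro z hz
    by_contra hcon
    set V := Metric.ball (0 : ℂ) 1 ∩ F ⁻¹' {0, 1}ᶜ with hV
    have hVo : IsOpen V :=
      hFc.isOpen_inter_preimage Metric.isOpen_ball (Set.toFinite {(0 : ℂ), 1}).isClosed.isOpen_compl
    have hpos' := diskPart_pos_of_isOpen hmono hpos hVo ⟨z, ⟨hz, hcon⟩, hz⟩
    refine hpos'.ne' (measure_mono_null (fun y hy => ?_) hFA)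
    intro hyA
    refine hy.2 ?_
    rw [show F y = A.indicator (fun _ => 1) y from hyA]
    by_cases hyA' : y ∈ A
    · simp [hyA']
    · simp [hyA']
  have hconst : ∀ z ∈ Metric.ball (0 : ℂ) 1, F z = F 0 := fun z hz =>
    (convex_ball (0 : ℂ) 1).isPreconnected.constant_of_mapsTo
      (Set.toFinite {(0 : ℂ), 1}).isDiscrete hFc hF01 hz (Metric.mem_ball_self one_pos)
  have hae : ∀ᵐ z ∂(diskPart G), F 0 = A.indicator (fun _ => 1) z := by
    filter_upwards [hFA, compl_mem_ae_iff.2 (diskPart_compl_ball G)] with z hz hzb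
    rw [← hz, hconst z (by simpa using hzb)]
  rcases hF01 (show (0 : ℂ) ∈ Metric.ball (0 : ℂ) 1 by simp) with h0 | h0
  · left
    refine measure_mono_null (fun z hz => ?_) hae
    change ¬ (F 0 = A.indicator (fun _ => 1) z)
    rw [indicator_of_mem hz, h0]
    exact zero_ne_one
  · right
    refine measure_mono_null (fun z hz => ?_) hae
    change ¬ (F 0 = A.indicator (fun _ => 1) z)
    rw [indicator_of_notMem hz, show F 0 = 1 from h0]
    exact one_ne_zero

/-! ### The part on the circle -/

theorem measurable_exp_mul_I : Measurable fun t : ℝ => Complex.exp (t * I) := by fun_prop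

theorem arclength_eq : arclength = ENNReal.ofReal (2 * Real.pi)⁻¹ •
    (volume.restrict (Ioc (-Real.pi) Real.pi)).map fun t : ℝ => Complex.exp (t * I) := by
  have : circleMap 0 1 = fun t : ℝ => Complex.exp (t * I) := by
    ext t; simp [circleMap]
  rw [arclength, this]

theorem map_restrict_le_arclength {J : Set ℝ} (hJ : J ⊆ Ioc (-Real.pi) Real.pi) {T : Set ℂ}
    (hT : MapsTo (fun t : ℝ => Complex.exp (t * I)) J T) :
    (volume.restrict J).map (fun t : ℝ => Complex.exp (t * I)) ≤
      ENNReal.ofReal (2 * Real.pi) • arclength.restrict T := by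
  have hpi := Real.pi_pos
  refine Measure.le_iff.2 fun s hs => ?_
  have e : ENNReal.ofReal (2 * Real.pi) * ENNReal.ofReal (2 * Real.pi)⁻¹ = 1 := by
    rw [← ENNReal.ofReal_mul (by positivity), mul_inv_cancel₀ (by positivity), ENNReal.ofReal_one]
  rw [Measure.map_apply measurable_exp_mul_I hs, Measure.smul_apply, smul_eq_mul,
    Measure.restrict_apply hs, arclength_eq, Measure.smul_apply, smul_eq_mul, ← mul_assoc, e,
    one_mul, Measure.restrict_apply (measurable_exp_mul_I hs)]
  refine le_trans ?_ (Measure.le_map_apply measurable_exp_mul_I.aemeasurable _)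
  rw [Measure.restrict_apply' measurableSet_Ioc]
  exact measure_mono fun t ht => ⟨⟨ht.1, hT ht.2⟩, hJ ht.2⟩

theorem ae_mem_sphere_arclength : ∀ᵐ z ∂arclength, z ∈ Metric.sphere (0 : ℂ) 1 := by
  rw [arclength_eq]
  refine Measure.ae_smul_measure ?_ _
  refine (ae_map_iff (p := fun z => z ∈ Metric.sphere (0 : ℂ) 1) measurable_exp_mul_I.aemeasurable
    Metric.isClosed_sphere.measurableSet).2 ?_
  exact ae_of_all _ fun t => by rw [mem_sphere_zero_iff_norm, Complex.norm_exp_ofReal_mul_I]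

/-- A bound in `L²(circlePart w)` in terms of an integral over an interval. -/
theorem integral_le_of_lintegral_circlePart_le {w : ℂ → ℝ} (hwmeas : Measurable w)
    (hwnonneg : ∀ z ∈ Metric.sphere (0 : ℂ) 1, 0 ≤ w z) {u : ℂ → ℝ} (hu : Measurable u)
    (hu0 : ∀ z, 0 ≤ u z) {J : Set ℝ} (hJ : J ⊆ Ioc (-Real.pi) Real.pi) {ε : ℝ} (hε : 0 ≤ ε)
    (h : ∫⁻ z, ENNReal.ofReal (u z) ∂(circlePart w) ≤ ENNReal.ofReal ((2 * Real.pi)⁻¹ * ε)) :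
    IntegrableOn (fun t : ℝ => w (Complex.exp (t * I)) * u (Complex.exp (t * I))) J ∧
      ∫ t in J, w (Complex.exp (t * I)) * u (Complex.exp (t * I)) ≤ ε := by
  have hpi := Real.pi_pos
  have hem := measurable_exp_mul_I
  have hw0 : ∀ t : ℝ, 0 ≤ w (Complex.exp (t * I)) := fun t =>
    hwnonneg _ (by rw [mem_sphere_zero_iff_norm, Complex.norm_exp_ofReal_mul_I])
  have hwu : Measurable fun z => ENNReal.ofReal (w z * u z) := (hwmeas.mul hu).ennreal_ofReal
  have hle : ∫⁻ t in J, ENNReal.ofReal (w (Complex.exp (t * I)) * u (Complex.exp (t * I))) ≤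
      ENNReal.ofReal ε := by
    calc _ = ∫⁻ z, ENNReal.ofReal (w z * u z)
          ∂((volume.restrict J).map fun t : ℝ => Complex.exp (t * I)) :=
            (lintegral_map hwu hem).symm
      _ ≤ ∫⁻ z, ENNReal.ofReal (w z * u z) ∂(ENNReal.ofReal (2 * Real.pi) • arclength) := by
          refine lintegral_mono' ?_ le_rfl
          have := map_restrict_le_arclength hJ (mapsTo_univ _ J)
          rwa [Measure.restrict_univ] at this
      _ = ENNReal.ofReal (2 * Real.pi) * ∫⁻ z, ENNReal.ofReal (u z) ∂(circlePart w) := by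
          rw [lintegral_smul_measure, smul_eq_mul, circlePart,
            lintegral_withDensity_eq_lintegral_mul _ hwmeas.ennreal_ofReal hu.ennreal_ofReal]
          congr 1
          refine lintegral_congr fun z => ?_
          rw [ENNReal.ofReal_mul' (hu0 z), Pi.mul_apply]
      _ ≤ ENNReal.ofReal (2 * Real.pi) * ENNReal.ofReal ((2 * Real.pi)⁻¹ * ε) := by gcongr
      _ = ENNReal.ofReal ε := by
          rw [← ENNReal.ofReal_mul (by positivity), mul_inv_cancel_left₀ (by positivity)]
  have hm : Measurable fun t : ℝ => w (Complex.exp (t * I)) * u (Complex.exp (t * I)) :=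
    (hwmeas.comp hem).mul (hu.comp hem)
  have h0 : ∀ t : ℝ, 0 ≤ w (Complex.exp (t * I)) * u (Complex.exp (t * I)) := fun t =>
    mul_nonneg (hw0 t) (hu0 _)
  constructor
  · refine ⟨hm.aestronglyMeasurable, ?_⟩
    rw [hasFiniteIntegral_iff_ofReal (ae_of_all _ h0)]
    exact hle.trans_lt ENNReal.ofReal_lt_top
  · rw [integral_eq_lintegral_of_nonneg_ae (ae_of_all _ h0) hm.aestronglyMeasurable]
    exact ENNReal.toReal_le_of_le_ofReal hε hle

/-- Every point of an open arc has a neighbourhood in the real line that is mapped to the arc. -/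
theorem IsOpenArc.exists_mapsTo_Ioo {T : Set ℂ} (hT : IsOpenArc T) {x₀ : ℝ}
    (hx : Complex.exp (x₀ * I) ∈ T) (hxpi : x₀ ∈ Ioo (-Real.pi) Real.pi) :
    ∃ r > 0, Ioo (x₀ - r) (x₀ + r) ⊆ Ioo (-Real.pi) Real.pi ∧
      MapsTo (fun t : ℝ => Complex.exp (t * I)) (Ioo (x₀ - r) (x₀ + r)) T := by
  obtain ⟨a, b, -, rfl⟩ := hT
  obtain ⟨t, ht, htx⟩ := hx
  have hexp : Complex.exp (x₀ * I) = Complex.exp (t * I) := by rw [← htx]; simp [circleMap]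
  obtain ⟨n, hn⟩ := Complex.exp_eq_exp_iff_exists_int.1 hexp
  have hn' : x₀ = t + n * (2 * Real.pi) := by
    have : (x₀ : ℂ) * I = (t + n * (2 * Real.pi)) * I := by rw [hn]; ring
    exact_mod_cast mul_right_cancel₀ Complex.I_ne_zero this
  refine ⟨min (min (x₀ + Real.pi) (Real.pi - x₀)) (min (t - a) (b - t)), ?_, ?_, ?_⟩
  · refine lt_min (lt_min ?_ ?_) (lt_min ?_ ?_) <;> linarith [hxpi.1, hxpi.2, ht.1, ht.2]
  · intro s hs
    have h1 : min (min (x₀ + Real.pi) (Real.pi - x₀)) (min (t - a) (b - t)) ≤ x₀ + Real.pi :=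
      (min_le_left _ _).trans (min_le_left _ _)
    have h2 : min (min (x₀ + Real.pi) (Real.pi - x₀)) (min (t - a) (b - t)) ≤ Real.pi - x₀ :=
      (min_le_left _ _).trans (min_le_right _ _)
    exact ⟨by linarith [hs.1], by linarith [hs.2]⟩
  · intro s hs
    have h1 : min (min (x₀ + Real.pi) (Real.pi - x₀)) (min (t - a) (b - t)) ≤ t - a :=
      (min_le_right _ _).trans (min_le_left _ _)
    have h2 : min (min (x₀ + Real.pi) (Real.pi - x₀)) (min (t - a) (b - t)) ≤ b - t :=
      (min_le_right _ _).trans (min_le_right _ _)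
    refine ⟨s - n * (2 * Real.pi), ⟨by linarith [hs.1], by linarith [hs.2]⟩, ?_⟩
    have : circleMap 0 1 (s - n * (2 * Real.pi)) = Complex.exp (s * I - n * (2 * Real.pi * I)) := by
      rw [circleMap]; push_cast; ring_nf
    rw [this, Complex.exp_sub, Complex.exp_int_mul_two_pi_mul_I, div_one]

/-- If `A` is null in the disk and its characteristic function belongs to the closure of the
polynomials, then `A` is null for the part of the measure on the circle. -/
theorem circlePart_eq_zero_of_diskPart_eq_zero {G : ℝ → ℝ} {w : ℂ → ℝ}
    (hmono : MonotoneOn G (Icc 0 1)) (hpos : ∀ x ∈ Ioo (0 : ℝ) 1, 0 < G x)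
    (hlt : ∀ x ∈ Ioo (0 : ℝ) 1, G x < 1) (hint : LogLogInt G)
    (hwmeas : Measurable w) (hwnonneg : ∀ z ∈ Metric.sphere (0 : ℂ) 1, 0 ≤ w z)
    (hwint : Integrable w arclength) {S : Set (Set ℂ)}
    (hS : ∀ T ∈ S, IsOpenArc T ∧ LogIntegrableOn w T) (hwS : carrierSet w =ᵐ[arclength] ⋃₀ S)
    {A : Set ℂ} (hA : MeasurableSet A) (hA0 : diskPart G A = 0)
    (happ : ∀ ε > 0, ∃ p : ℂ[X],
      ∫⁻ z, ‖p.eval z - A.indicator (fun _ => 1) z‖ₑ ^ 2 ∂(diskCircleMeasure G w) ≤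
        ENNReal.ofReal ε) :
    circlePart w A = 0 := by
  have hpi := Real.pi_pos
  set e : ℝ → ℂ := fun t => Complex.exp (t * I) with he
  have hem : Measurable e := measurable_exp_mul_I
  -- The local statement, at the points of the given arcs.
  have hnull : volume (e ⁻¹' A ∩ e ⁻¹' (⋃₀ S) ∩ Ioo (-Real.pi) Real.pi) = 0 := by
    refine measure_null_of_locally_null _ fun x₀ hx₀ => ?_
    obtain ⟨⟨-, T, hTS, hxT⟩, hxpi⟩ := hx₀
    obtain ⟨hTarc, hTpos, hTlog⟩ := hS T hTS
    obtain ⟨r, hr, hJpi, hJT⟩ := hTarc.exists_mapsTo_Ioo hxT hxpi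
    have hJ : Ioo (x₀ - r) (x₀ + r) ⊆ Ioc (-Real.pi) Real.pi := hJpi.trans Ioo_subset_Ioc_self
    have hmap := map_restrict_le_arclength hJ hJT
    have hi : ∀ u : ℂ → ℝ, IntegrableOn u T arclength →
        IntegrableOn (fun s => u (e s)) (Ioo (x₀ - r) (x₀ + r)) := fun u hu =>
      ((Integrable.smul_measure hu ENNReal.ofReal_ne_top).mono_measure hmap).comp_measurable hem
    have hWpos : ∀ᵐ s ∂volume.restrict (Ioo (x₀ - r) (x₀ + r)), 0 < w (e s) :=
      ae_of_ae_map hem.aemeasurable ((Measure.absolutelyContinuous_of_le_smul hmap).ae_le hTpos)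
    obtain ⟨c, hc, hc0⟩ := exists_volume_preimage_inter_eq_zero hmono hpos hlt hint hA hr hWpos
      (hi w hwint.integrableOn) (hi _ hTlog) (by
        intro ε hε
        obtain ⟨p, hp⟩ := happ (min ε ((2 * Real.pi)⁻¹ * ε)) (by positivity)
        rw [diskCircleMeasure, lintegral_add_measure] at hp
        refine ⟨p, ?_, ?_⟩
        · have hae : ∀ᵐ z ∂(diskPart G), z ∉ A := measure_eq_zero_iff_ae_notMem.1 hA0
          calc ∫⁻ ζ, ‖p.eval ζ‖ₑ ^ 2 ∂(diskPart G)
              = ∫⁻ z, ‖p.eval z - A.indicator (fun _ => 1) z‖ₑ ^ 2 ∂(diskPart G) :=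
                lintegral_congr_ae (hae.mono fun z hz => by simp [hz])
            _ ≤ _ := le_self_add.trans (hp.trans (ENNReal.ofReal_le_ofReal (min_le_left _ _)))
        · refine integral_le_of_lintegral_circlePart_le (u := fun z =>
            ‖p.eval z - A.indicator (fun _ => 1) z‖ ^ 2) hwmeas hwnonneg
            ((p.continuous.measurable.sub (measurable_const.indicator hA)).norm.pow_const 2)
            (fun z => by positivity) hJ hε.le ?_
          refine le_trans (le_of_eq ?_)
            (le_add_self.trans (hp.trans (ENNReal.ofReal_le_ofReal (min_le_right _ _))))
          refine lintegral_congr fun z => ?_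
          rw [ENNReal.ofReal_pow (norm_nonneg _), ofReal_norm])
    refine ⟨_, inter_mem_nhdsWithin _ (Ioo_mem_nhds (show x₀ - c < x₀ by linarith)
      (show x₀ < x₀ + c by linarith)), measure_mono_null (fun t ht => ?_) hc0⟩
    exact ⟨ht.1.1.1, ht.2⟩
  -- Passage from the real line to the circle.
  have hcm : MeasurableSet (carrierSet w) :=
    Metric.isClosed_sphere.measurableSet.inter (measurableSet_lt measurable_const hwmeas)
  have hdiff : volume (e ⁻¹' (carrierSet w \ ⋃₀ S) ∩ Ioc (-Real.pi) Real.pi) = 0 := by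
    have h1 : arclength (carrierSet w \ ⋃₀ S) = 0 := ae_le_set.1 hwS.le
    rw [arclength_eq, Measure.smul_apply, smul_eq_mul, mul_eq_zero,
      or_iff_right (ENNReal.ofReal_pos.2 (by positivity)).ne'] at h1
    have h2 := le_antisymm ((Measure.le_map_apply hem.aemeasurable _).trans h1.le) zero_le
    rwa [Measure.restrict_apply' measurableSet_Ioc] at h2
  have hAc : arclength (A ∩ carrierSet w) = 0 := by
    rw [arclength_eq, Measure.smul_apply, Measure.map_apply hem (hA.inter hcm),
      ← restrict_Ioo_eq_restrict_Ioc, Measure.restrict_apply' measurableSet_Ioo]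
    suffices h : volume (e ⁻¹' (A ∩ carrierSet w) ∩ Ioo (-Real.pi) Real.pi) = 0 by
      rw [h, smul_zero]
    refine measure_mono_null (fun t ht => ?_) (measure_union_null hdiff hnull)
    by_cases h : e t ∈ ⋃₀ S
    · exact Or.inr ⟨⟨ht.1.1, h⟩, ht.2⟩
    · exact Or.inl ⟨⟨ht.1.2, h⟩, Ioo_subset_Ioc_self ht.2⟩
  rw [circlePart, withDensity_apply _ hA, setLIntegral_eq_zero_iff hA hwmeas.ennreal_ofReal]
  filter_upwards [measure_eq_zero_iff_ae_notMem.1 hAc, ae_mem_sphere_arclength] with z hz hz1 hzA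
  rw [ENNReal.ofReal_eq_zero]
  by_contra! h
  exact hz ⟨hzA, hz1, h⟩

end MeanSquareApprox

theorem mainTheorem4
    (G : ℝ → ℝ) (w : ℂ → ℝ)
    (hG0 : G 0 = 0) (hGmono : MonotoneOn G (Icc 0 1))
    (hGpos : ∀ x ∈ Ioo (0 : ℝ) 1, 0 < G x) (hGlt : ∀ x ∈ Ioo (0 : ℝ) 1, G x < 1)
    (hGdiff : ContDiffOn ℝ 1 G (Ioo 0 1))
    (hGint : MeanSquareApprox.LogLogInt G)
    (hwmeas : Measurable w) (hwnonneg : ∀ z ∈ Metric.sphere (0 : ℂ) 1, 0 ≤ w z)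
    (hwint : Integrable w MeanSquareApprox.arclength)
    (hw : ∃ S : Set (Set ℂ),
      (∀ I ∈ S, MeanSquareApprox.IsOpenArc I ∧ MeanSquareApprox.LogIntegrableOn w I) ∧
        MeanSquareApprox.carrierSet w =ᵐ[MeanSquareApprox.arclength] ⋃₀ S) :
    MeanSquareApprox.IsIrreducibleP2 (MeanSquareApprox.diskCircleMeasure G w) := by
  obtain ⟨S, hS, hwS⟩ := hw
  intro A hA f hf hfA
  have happ := fun ε (hε : (0 : ℝ) < ε) =>
    MeanSquareApprox.exists_lintegral_enorm_eval_sub_le hf hfA hε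
  -- `1 - p` approximates the characteristic function of the complement as well as `p` does that
  -- of `A`.
  have happ' : ∀ ε > 0, ∃ p : ℂ[X], ∫⁻ z, ‖p.eval z - Aᶜ.indicator (fun _ => 1) z‖ₑ ^ 2
      ∂(MeanSquareApprox.diskCircleMeasure G w) ≤ ENNReal.ofReal ε := by
    intro ε hε
    obtain ⟨p, hp⟩ := happ ε hε
    refine ⟨1 - p, (le_of_eq (lintegral_congr fun z => ?_)).trans hp⟩
    have hind : Aᶜ.indicator (fun _ => (1 : ℂ)) z = 1 - A.indicator (fun _ => 1) z := by
      by_cases h : z ∈ A <;> simp [h]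
    rw [hind, eval_sub, eval_one, sub_sub_sub_cancel_left, enorm_sub_rev]
  have hdisk := MeanSquareApprox.diskPart_eq_zero_or_compl hGmono hGpos hA fun ε hε =>
    (happ ε hε).imp fun p hp => le_trans (lintegral_mono' (Measure.le_add_right le_rfl) le_rfl) hp
  refine hdisk.imp (fun h => ?_) fun h => ?_
  · rw [MeanSquareApprox.diskCircleMeasure, Measure.add_apply, h, zero_add]
    exact MeanSquareApprox.circlePart_eq_zero_of_diskPart_eq_zero hGmono hGpos hGlt hGint hwmeas
      hwnonneg hwint hS hwS hA h happ
  · rw [MeanSquareApprox.diskCircleMeasure, Measure.add_apply, h, zero_add]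
    exact MeanSquareApprox.circlePart_eq_zero_of_diskPart_eq_zero hGmono hGpos hGlt hGint hwmeas
      hwnonneg hwint hS hwS hA.compl h happ'
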